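/- For $\tau$ in the upper half plane let $\wp(\tau;z)$ be the Weierstrass function of the lattice $\Lambda=\mathbb Z+\mathbb Z\tau$, let $g_2(\tau)=60\sum_{0\ne\omega\in\Lambda}\omega^{-4}$, and put $\omega_2=\tfrac{\tau}{2}$, $\omega_3=\tfrac12+\tfrac{\tau}{2}$. Consider the Neumann problem $$W''+6W^2-\lambda=0 \ \text{ on } (0,\tfrac12),\qquad W'(0)=W'(\tfrac12)=0, \tag{N}$$ for real-valued $W$ of class $C^1$ on $[0,\tfrac12]$, twice differentiable on $(0,\tfrac12)$, and $\lambda\in\mathbb R$. 1. The pair $(\lambda,W)$ is a non-constant real solution of (N) if and only if there are an integer $n\ge1$ and a purely imaginary $\tau=i\theta$, $\theta>0$, such that $\lambda=\tfrac12n^4g_2(\tau)$ and either $W(x)=-n^2\wp(\tau;\omega_2+nx)$ for all $x\in[0,\tfrac12]$, or $W(x)=-n^2\wp(\tau;\omega_3+nx)$ for all $x\in[0,\tfrac12]$. 2. For $n\ge1$ and $|h|<1$ put $$\lambda_n(h)=\tfrac23(n\pi)^4\Big(1+240\sum_{k\ge1}\sigma_3(k)h^{2k}\Big),\qquad \eta(h)=\tfrac13-8\sum_{k\ge1}k\,\frac{h^{2k}}{1-h^{2k}},$$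 $$W_n(h)(x)=(n\pi)^2\Big(\eta(h)+8\sum_{k\ge1}k\,\frac{h^k}{1-h^{2k}}\cos(2\pi nkx)\Big),$$ where $\sigma_3(k)$ is the sum of the cubes of the positive divisors of $k$. These series converge absolutely. For all $n\ge1$, $\tau=i\theta$ with $\theta>0$, and all real $x$: $\tfrac12n^4g_2(\tau)=\lambda_n(h)$ for both $h=\pm e^{-\pi\theta}$; $-n^2\wp(\tau;\omega_2+nx)=W_n(h)(x)$ for $h=+e^{-\pi\theta}$; and $-n^2\wp(\tau;\omega_3+nx)=W_n(h)(x)$ for $h=-e^{-\pi\theta}$. 3. For every $n\ge1$, at $h=0$, we have $\lambda_n(0)=\lambda_{n0}:=\tfrac23(n\pi)^4$ and $W_n(0)\equiv\tfrac13(n\pi)^2=\sqrt{\lambda_{n0}/6}$. There the curve $h\mapsto(\lambda_n(h),W_n(h))$ branches off the branch $W_\infty(\lambda)\equiv\sqrt{\lambda/6}$ of constant solutions in a supercritical pitchfork. That is, both branches are smooth near the bifurcation point, as curves in $\mathbb R\times C([0,\tfrac12])$ with the supremum norm; $\lambda_n'(0)=0$, $\lambda_n''(0)>0$, and $\tfrac{d}{dh}W_n(h)|_{h=0}\ne0$;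 and, for all sufficiently small $\varepsilon>0$, in some neighbourhood (depending on $\varepsilon$) of $(\lambda_{n0},W_\infty(\lambda_{n0}))$ in $\mathbb R\times C([0,\tfrac12])$ the real solutions $(\lambda,W)$ of (N) are exactly the points on $W=W_\infty(\lambda)$ and the points $(\lambda_n(h),W_n(h))$ with $|h|<\varepsilon$. -/

import Mathlib

open Set Filter Topology
open scoped ContDiff UpperHalfPlane

noncomputable section

/-- The period pair `(1, τ)`, for `τ` in the upper half plane. -/
def unitPeriodPair (τ : ℍ) : PeriodPair where
  ω₁ := 1
  ω₂ := (τ : ℂ)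
  indep := by
    rw [LinearIndependent.pair_iff]
    intro s t hst
    have h1 := congrArg Complex.im hst
    have h2 := congrArg Complex.re hst
    simp only [Complex.real_smul, mul_one, Complex.add_im, Complex.ofReal_im, Complex.re_ofReal_mul,
      Complex.im_ofReal_mul, Complex.zero_im, zero_add, Complex.add_re, Complex.ofReal_re,
      Complex.zero_re] at h1 h2
    have ht : t = 0 := by
      rcases mul_eq_zero.mp h1 with h | h
      · exact h
      · exact absurd h τ.im_pos.ne'
    subst ht
    simpa using h2

/-- The Weierstrass function `℘(τ; z)` of the lattice `ℤ + ℤ τ`. -/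
def wpFun (τ : ℍ) (z : ℂ) : ℂ := (unitPeriodPair τ).weierstrassP z

/-- The invariant `g₂(τ) = 60 ∑ ω⁻⁴`, over the nonzero points `ω` of the lattice `ℤ + ℤ τ`. -/
def gTwo (τ : ℍ) : ℂ := (unitPeriodPair τ).g₂

/-- `W` is a real classical solution, of class `C¹` on `[0, 1/2]` and twice differentiable on
`(0, 1/2)`, of the Neumann problem `W'' + 6 W² - lam = 0` on `(0, 1/2)`, `W'(0) = W'(1/2) = 0`.
Only the values of `W` on `[0, 1/2]` matter. -/
structure IsNeumannSolution (lam : ℝ) (W : ℝ → ℝ) : Prop where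
  contDiffOn : ContDiffOn ℝ 1 W (Icc 0 (1 / 2))
  differentiableAt : ∀ x ∈ Ioo (0 : ℝ) (1 / 2), DifferentiableAt ℝ (deriv W) x
  ode : ∀ x ∈ Ioo (0 : ℝ) (1 / 2), deriv (deriv W) x + 6 * W x ^ 2 - lam = 0
  neumann_left : derivWithin W (Icc 0 (1 / 2)) 0 = 0
  neumann_right : derivWithin W (Icc 0 (1 / 2)) (1 / 2) = 0

/-- All pairs `(lam, W)` of a parameter and a real Neumann solution, constant or not, as a subset
of `ℝ × C([0, 1/2])`, where `C([0, 1/2])` carries the supremum norm. -/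
def neumannSolutionSet : Set (ℝ × C(Icc (0 : ℝ) (1 / 2), ℝ)) :=
  {p | ∃ W : ℝ → ℝ, IsNeumannSolution p.1 W ∧ ∀ x : Icc (0 : ℝ) (1 / 2), p.2 x = W x}

/-- `(2/3) (n π)⁴ (1 + 240 ∑_{k ≥ 1} σ₃(k) h^{2k})`. -/
def lambdaFourier (n : ℕ) (h : ℝ) : ℝ :=
  2 / 3 * (n * Real.pi) ^ 4 *
    (1 + 240 * ∑' k : ℕ+, (ArithmeticFunction.sigma 3 (k : ℕ) : ℝ) * h ^ (2 * (k : ℕ)))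

/-- `1/3 - 8 ∑_{k ≥ 1} k h^{2k} / (1 - h^{2k})`. -/
def etaFourier (h : ℝ) : ℝ :=
  1 / 3 - 8 * ∑' k : ℕ+, (k : ℝ) * (h ^ (2 * (k : ℕ)) / (1 - h ^ (2 * (k : ℕ))))

/-- `(n π)² (η + 8 ∑_{k ≥ 1} k h^k / (1 - h^{2k}) cos(2 π n k x))`. -/
def waveFourier (n : ℕ) (h x : ℝ) : ℝ :=
  (n * Real.pi) ^ 2 *
    (etaFourier h + 8 * ∑' k : ℕ+, (k : ℝ) * (h ^ (k : ℕ) / (1 - h ^ (2 * (k : ℕ)))) *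
      Real.cos (2 * Real.pi * n * k * x))

/-- Supercritical pitchfork bifurcation of a solution set `S ⊆ ℝ × X` at parameter `lam₀`:
a smooth curve `s ↦ (Λ s, w s)` branches off the smooth trivial branch `lam ↦ (lam, U lam)` at
`s = 0`; it is transverse to the trivial branch (`Λ' = 0`, `w' ≠ 0` at `s = 0`), it opens
quadratically towards `lam > lam₀` on both sides `s > 0` and `s < 0` (`Λ'' > 0` at `s = 0`),
and near the bifurcation point `S` is exactly the union of the two curves. -/
structure IsSupercriticalPitchfork {X : Type*} [NormedAddCommGroup X] [NormedSpace ℝ X]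
    (S : Set (ℝ × X)) (U : ℝ → X) (lam₀ : ℝ) (Λ : ℝ → ℝ) (w : ℝ → X) : Prop where
  smooth_trivial : ContDiffAt ℝ ∞ U lam₀
  smooth_param : ContDiffAt ℝ ∞ Λ 0
  smooth_branch : ContDiffAt ℝ ∞ w 0
  param_zero : Λ 0 = lam₀
  branch_zero : w 0 = U lam₀
  deriv_param : deriv Λ 0 = 0
  supercritical : 0 < deriv (deriv Λ) 0
  transverse : deriv w 0 ≠ 0
  local_solutions : ∀ᶠ ε in 𝓝[>] (0 : ℝ), ∀ᶠ p in 𝓝 (lam₀, U lam₀),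
    (p ∈ S ↔ (p.2 = U p.1 ∨ ∃ s : ℝ, |s| < ε ∧ p = (Λ s, w s)))

end

/-! Summing the lattice series of `℘` row by row, with the Lipschitz formula for each row off the
real axis, yields its Fourier series on the line through `τ / 2` (`wpFun_fourier`); the q-expansion
of the weight 4 Eisenstein series does the same for `g₂` (`gTwo_eq`). So for imaginary `τ` the real
Fourier series inherit the differentiated Weierstrass equation, and their reflection symmetries
supply the Neumann conditions.

Conversely, a non-constant solution attains its minimum m and maximum M at critical points.
Conservation of energy gives λ = 2(M² + Mm + m²) and W'² = 4(M - W)(W - m)(W + M + m), which forces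
M + 2m > 0 (`SolvesOn.exists_extremes`). Every such pair is, up to a factor c², the pair of extremes
of a wave with h in (0, 1) (`exists_wave_of_extremes`): the ratio (M - m)/(2M + m) vanishes at h =
0, the inversion τ ↦ -1/τ replaces it by one minus itself, and continuity fills in (0, 1).
Uniqueness for the ODE then identifies W with a scaled translate of the wave. Since the wave has
critical points only at half-integers, the Neumann conditions make c an integer and the translation
a multiple of half a period, which amounts to the choice between h and -h.

For the pitchfork, the series extend holomorphically to the unit disc, so smoothness is automatic.
Positivity of the coefficients makes λ grow at least quadratically in h (`lambdaFourier_ge`) and the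
oscillation of the wave at least linearly in |h| (`waveFourier_gap`). These bounds give the sign of
λ'' and transversality; together with the classification they isolate mode n near the bifurcation
point. -/

/-! ### Convergence and holomorphy of the series in the unit disc -/

lemma summable_pnat_pow_mul_geometric (j : ℕ) {r : ℝ} (hr0 : 0 ≤ r) (hr : r < 1) :
    Summable fun k : ℕ+ => (k : ℝ) ^ j * r ^ (k : ℕ) :=
  (summable_pow_mul_geometric_of_norm_lt_one (R := ℝ) j
    (by rwa [Real.norm_of_nonneg hr0])).comp_injective PNat.coe_injective

lemma one_sub_pow_ne_zero {𝕜 : Type*} [RCLike 𝕜] {z : 𝕜} (hz : ‖z‖ < 1) {k : ℕ} (hk : k ≠ 0) :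
    1 - z ^ k ≠ 0 := by
  intro h
  have h1 : ‖z ^ k‖ = 1 := by rw [← sub_eq_zero.mp h, norm_one]
  rw [norm_pow] at h1
  exact (pow_lt_one₀ (norm_nonneg z) hz hk).ne h1

/-- The denominator stays at distance at least 1 - r from 0, so one geometric majorant works on the
whole disc of radius r. The free exponent `e` covers both series, with numerators `z ^ k` and `z ^
(2 * k)`. -/
lemma norm_lambert_le {𝕜 : Type*} [RCLike 𝕜] {e : ℕ} {k : ℕ+} (he : (k : ℕ) ≤ e) {r : ℝ}
    (hr : r < 1) {z : 𝕜} (hz : ‖z‖ ≤ r) :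
    ‖((k : ℕ) : 𝕜) * (z ^ e / (1 - z ^ (2 * (k : ℕ))))‖ ≤ (k : ℝ) ^ 1 * r ^ (k : ℕ) / (1 - r) := by
  have hr0 : 0 ≤ r := (norm_nonneg z).trans hz
  have h1 : 1 - r ≤ ‖1 - z ^ (2 * (k : ℕ))‖ := by
    have h2 : ‖z ^ (2 * (k : ℕ))‖ ≤ r := by
      rw [norm_pow]
      refine (pow_le_of_le_one (norm_nonneg z) (hz.trans hr.le) (by positivity)).trans hz
    have h3 := norm_sub_norm_le (1 : 𝕜) (z ^ (2 * (k : ℕ)))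
    rw [norm_one] at h3
    linarith
  have h4 : ‖z‖ ^ e ≤ r ^ (k : ℕ) :=
    (pow_le_pow_left₀ (norm_nonneg z) hz e).trans (pow_le_pow_of_le_one hr0 hr.le he)
  rw [norm_mul, norm_div, norm_pow, RCLike.norm_natCast, pow_one, mul_div_assoc]
  have h5 : 0 < 1 - r := by linarith
  gcongr

lemma summable_lambert_smul {𝕜 E : Type*} [RCLike 𝕜] [NormedAddCommGroup E] [NormedSpace 𝕜 E]
    [CompleteSpace E] {e : ℕ+ → ℕ} (he : ∀ k : ℕ+, (k : ℕ) ≤ e k) {v : ℕ+ → E} (hv : ∀ k, ‖v k‖ ≤ 1)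
    {z : 𝕜} (hz : ‖z‖ < 1) :
    Summable fun k : ℕ+ => (((k : ℕ) : 𝕜) * (z ^ e k / (1 - z ^ (2 * (k : ℕ))))) • v k := by
  refine Summable.of_norm_bounded
    (((summable_pnat_pow_mul_geometric 1 (norm_nonneg z) hz)).div_const (1 - ‖z‖)) fun k => ?_
  rw [norm_smul]
  exact (mul_le_of_le_one_right (norm_nonneg _) (hv k)).trans (norm_lambert_le (he k) hz le_rfl)

lemma summable_lambert {𝕜 : Type*} [RCLike 𝕜] {e : ℕ+ → ℕ} (he : ∀ k : ℕ+, (k : ℕ) ≤ e k)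
    {z : 𝕜} (hz : ‖z‖ < 1) :
    Summable fun k : ℕ+ => ((k : ℕ) : 𝕜) * (z ^ e k / (1 - z ^ (2 * (k : ℕ)))) := by
  simpa using summable_lambert_smul he (v := fun _ => (1 : 𝕜)) (by simp) hz

/-- Weierstrass M-test on each smaller disc. Values in a Banach space allow its use for scalar
series and for curves in a space of continuous functions alike. -/
lemma differentiableOn_tsum_unit_ball {E : Type*} [NormedAddCommGroup E] [NormedSpace ℂ E]
    [CompleteSpace E] {f : ℕ+ → ℂ → E} (hf : ∀ k, DifferentiableOn ℂ (f k) (Metric.ball 0 1))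
    {u : ℝ → ℕ+ → ℝ} (hu : ∀ r, 0 ≤ r → r < 1 → Summable (u r))
    (hfu : ∀ r, r < 1 → ∀ k z, ‖z‖ ≤ r → ‖f k z‖ ≤ u r k) :
    DifferentiableOn ℂ (fun z => ∑' k, f k z) (Metric.ball 0 1) := by
  intro z hz
  rw [mem_ball_zero_iff] at hz
  obtain ⟨r, hzr, hr⟩ := exists_between hz
  have h := Complex.differentiableOn_tsum_of_summable_norm (U := Metric.ball 0 r) (F := f)
    (hu r ((norm_nonneg z).trans hzr.le) hr)
    (fun k => (hf k).mono (Metric.ball_subset_ball hr.le)) Metric.isOpen_ball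
    (fun k w hw => hfu r hr k w (mem_ball_zero_iff.mp hw).le)
  exact ((h z (mem_ball_zero_iff.mpr hzr)).differentiableAt
    (Metric.isOpen_ball.mem_nhds (mem_ball_zero_iff.mpr hzr))).differentiableWithinAt

lemma differentiableOn_tsum_lambert_smul {E : Type*} [NormedAddCommGroup E] [NormedSpace ℂ E]
    [CompleteSpace E] {e : ℕ+ → ℕ} (he : ∀ k : ℕ+, (k : ℕ) ≤ e k) {v : ℕ+ → E} (hv : ∀ k, ‖v k‖ ≤ 1) :
    DifferentiableOn ℂ
      (fun z : ℂ => ∑' k : ℕ+, (((k : ℕ) : ℂ) * (z ^ e k / (1 - z ^ (2 * (k : ℕ))))) • v k)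
      (Metric.ball 0 1) := by
  refine differentiableOn_tsum_unit_ball (u := fun r k => (k : ℝ) ^ 1 * r ^ (k : ℕ) / (1 - r))
    (fun k => ?_) (fun r hr0 hr => (summable_pnat_pow_mul_geometric 1 hr0 hr).div_const _)
    fun r hr k z hz => ?_
  · refine DifferentiableOn.smul_const (DifferentiableOn.const_mul (DifferentiableOn.div
      (by fun_prop) (by fun_prop) fun z hz => ?_) _) _
    exact one_sub_pow_ne_zero (mem_ball_zero_iff.mp hz) (by positivity)
  · rw [norm_smul]
    exact (mul_le_of_le_one_right (norm_nonneg _) (hv k)).trans (norm_lambert_le (he k) hr hz)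

lemma norm_sigma_mul_pow_le {𝕜 : Type*} [RCLike 𝕜] {r : ℝ} (hr : r < 1) (k : ℕ+) {z : 𝕜}
    (hz : ‖z‖ ≤ r) :
    ‖((ArithmeticFunction.sigma 3 (k : ℕ) : ℕ) : 𝕜) * z ^ (2 * (k : ℕ))‖
      ≤ (k : ℝ) ^ 4 * r ^ (k : ℕ) := by
  have hr0 : 0 ≤ r := (norm_nonneg z).trans hz
  rw [norm_mul, norm_pow, RCLike.norm_natCast]
  have h1 : (ArithmeticFunction.sigma 3 (k : ℕ) : ℝ) ≤ (k : ℝ) ^ 4 := by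
    exact_mod_cast ArithmeticFunction.sigma_le_pow_succ 3 k
  have h2 : ‖z‖ ^ (2 * (k : ℕ)) ≤ r ^ (k : ℕ) :=
    (pow_le_pow_left₀ (norm_nonneg z) hz _).trans (pow_le_pow_of_le_one hr0 hr.le (by omega))
  gcongr

lemma summable_sigma_mul_pow {𝕜 : Type*} [RCLike 𝕜] {z : 𝕜} (hz : ‖z‖ < 1) :
    Summable fun k : ℕ+ => ((ArithmeticFunction.sigma 3 (k : ℕ) : ℕ) : 𝕜) * z ^ (2 * (k : ℕ)) :=
  Summable.of_norm_bounded (summable_pnat_pow_mul_geometric 4 (norm_nonneg z) hz)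
    fun k => norm_sigma_mul_pow_le hz k le_rfl

lemma differentiableOn_tsum_sigma_mul_pow :
    DifferentiableOn ℂ
      (fun z : ℂ => ∑' k : ℕ+, ((ArithmeticFunction.sigma 3 (k : ℕ) : ℕ) : ℂ) * z ^ (2 * (k : ℕ)))
      (Metric.ball 0 1) :=
  differentiableOn_tsum_unit_ball (u := fun r k => (k : ℝ) ^ 4 * r ^ (k : ℕ))
    (fun k => by fun_prop) (fun r hr0 hr => summable_pnat_pow_mul_geometric 4 hr0 hr)
    fun r hr k z hz => norm_sigma_mul_pow_le hr k hz

lemma summable_lambert_mul_cos {h : ℝ} (hh : |h| < 1) (n : ℕ) (x : ℝ) :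
    Summable fun k : ℕ+ => (k : ℝ) * (h ^ (k : ℕ) / (1 - h ^ (2 * (k : ℕ)))) *
      Real.cos (2 * Real.pi * n * k * x) := by
  have := summable_lambert_smul (e := fun k => (k : ℕ)) (fun k => le_rfl) (𝕜 := ℝ)
    (v := fun k : ℕ+ => Real.cos (2 * Real.pi * n * k * x))
    (fun k => Real.abs_cos_le_one _) (z := h) hh
  simpa using this

lemma summable_lambert_even {h : ℝ} (hh : |h| < 1) :
    Summable fun k : ℕ+ => (k : ℝ) * (h ^ (2 * (k : ℕ)) / (1 - h ^ (2 * (k : ℕ)))) :=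
  summable_lambert (e := fun k => 2 * (k : ℕ)) (fun k => by omega) (z := h) hh

/-! ### Smoothness in `h` -/

/-- Complex differentiability on an open set gives smoothness of every order, so no series has to be
differentiated term by term. -/
lemma contDiffAt_comp_ofReal {E : Type*} [NormedAddCommGroup E] [NormedSpace ℂ E]
    [NormedSpace ℝ E] [IsScalarTower ℝ ℂ E] [CompleteSpace E] {F : ℂ → E}
    (hF : DifferentiableOn ℂ F (Metric.ball 0 1)) {h : ℝ} (hh : |h| < 1) (N : WithTop ℕ∞) :
    ContDiffAt ℝ N (fun t : ℝ => F t) h := by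
  have hmem : (h : ℂ) ∈ Metric.ball (0 : ℂ) 1 := by simpa using hh
  have h1 : ContDiffAt ℂ N F h :=
    (hF.contDiffOn Metric.isOpen_ball).contDiffAt (Metric.isOpen_ball.mem_nhds hmem)
  exact (h1.restrict_scalars ℝ).comp h Complex.ofRealCLM.contDiff.contDiffAt

lemma contDiffAt_lambdaFourier (n : ℕ) {h : ℝ} (hh : |h| < 1) (N : WithTop ℕ∞) :
    ContDiffAt ℝ N (lambdaFourier n) h := by
  have h1 := contDiffAt_comp_ofReal differentiableOn_tsum_sigma_mul_pow hh N
  have h2 : ContDiffAt ℝ N (fun t : ℝ => ∑' k : ℕ+,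
      (ArithmeticFunction.sigma 3 (k : ℕ) : ℝ) * t ^ (2 * (k : ℕ))) h := by
    refine (Complex.reCLM.contDiff.contDiffAt.comp h h1).congr_of_eventuallyEq
      (Eventually.of_forall fun t => ?_)
    simp only [Function.comp_apply, Complex.reCLM_apply]
    rw [← Complex.ofReal_re (∑' k : ℕ+, _), Complex.ofReal_tsum]
    push_cast
    rfl
  exact contDiffAt_const.mul (contDiffAt_const.add (contDiffAt_const.mul h2))

/-- The cosine modes, as complex-valued continuous functions on `[0, 1/2]`. -/
noncomputable def cosMode (n : ℕ) (k : ℕ+) : C(Icc (0 : ℝ) (1 / 2), ℂ) :=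
  ⟨fun x => (Real.cos (2 * Real.pi * n * k * x) : ℝ), by fun_prop⟩

lemma norm_cosMode_le (n : ℕ) (k : ℕ+) : ‖cosMode n k‖ ≤ 1 := by
  rw [ContinuousMap.norm_le _ zero_le_one]
  intro x
  simpa only [cosMode, ContinuousMap.coe_mk, Complex.norm_real] using! Real.abs_cos_le_one _

/-- The Fourier branch for complex values of `h`, with values in `C([0, 1/2], ℂ)`. -/
noncomputable def complexBranch (n : ℕ) (z : ℂ) : C(Icc (0 : ℝ) (1 / 2), ℂ) :=
  ((n * Real.pi : ℂ) ^ 2 * (1 / 3 - 8 *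
      ∑' k : ℕ+, (((k : ℕ) : ℂ) * (z ^ (2 * (k : ℕ)) / (1 - z ^ (2 * (k : ℕ))))) • (1 : ℂ))) •
      (1 : C(Icc (0 : ℝ) (1 / 2), ℂ)) +
    ((n * Real.pi : ℂ) ^ 2 * 8) •
      ∑' k : ℕ+, (((k : ℕ) : ℂ) * (z ^ (k : ℕ) / (1 - z ^ (2 * (k : ℕ))))) • cosMode n k

lemma differentiableOn_complexBranch (n : ℕ) :
    DifferentiableOn ℂ (complexBranch n) (Metric.ball 0 1) := by
  have h1 := differentiableOn_tsum_lambert_smul (e := fun k => 2 * (k : ℕ)) (fun k => by omega)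
    (v := fun _ => (1 : ℂ)) (by simp)
  have h2 := differentiableOn_tsum_lambert_smul (e := fun k => (k : ℕ)) (fun k => le_rfl)
    (norm_cosMode_le n)
  exact ((((h1.const_mul 8).const_sub (1 / 3)).const_mul _).smul_const _).add (h2.fun_const_smul _)

/-- The branch `h ↦ W_n(h)` as a curve in `C([0, 1/2])`. -/
noncomputable def realBranch (n : ℕ) (h : ℝ) : C(Icc (0 : ℝ) (1 / 2), ℝ) :=
  Complex.reCLM.compLeftContinuous ℝ (Icc (0 : ℝ) (1 / 2)) (complexBranch n h)

lemma contDiffAt_realBranch (n : ℕ) {h : ℝ} (hh : |h| < 1) (N : WithTop ℕ∞) :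
    ContDiffAt ℝ N (realBranch n) h :=
  (Complex.reCLM.compLeftContinuous ℝ (Icc (0 : ℝ) (1 / 2))).contDiff.contDiffAt.comp h
    (contDiffAt_comp_ofReal (differentiableOn_complexBranch n) hh N)

lemma realBranch_apply (n : ℕ) {h : ℝ} (hh : |h| < 1) (x : Icc (0 : ℝ) (1 / 2)) :
    realBranch n h x = waveFourier n h x := by
  have hs := summable_lambert_smul (e := fun k => (k : ℕ)) (fun k => le_rfl)
    (norm_cosMode_le n) (z := (h : ℂ)) (by simpa using hh)
  have h1 : complexBranch n h x = (waveFourier n h x : ℂ) := by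
    simp only [complexBranch, ContinuousMap.add_apply, ContinuousMap.smul_apply,
      ContinuousMap.one_apply]
    rw [← ContinuousMap.tsum_apply hs]
    simp only [waveFourier, etaFourier, cosMode, ContinuousMap.smul_apply, ContinuousMap.coe_mk]
    push_cast
    simp only [smul_eq_mul, mul_one]
    ring
  simp [realBranch, h1]

lemma contDiffAt_waveFourier (n : ℕ) {h x : ℝ} (hh : |h| < 1) (hx : x ∈ Icc (0 : ℝ) (1 / 2))
    (N : WithTop ℕ∞) : ContDiffAt ℝ N (fun t => waveFourier n t x) h := by
  have h1 : ContDiffAt ℝ N (fun t => realBranch n t ⟨x, hx⟩) h :=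
    (ContinuousMap.evalCLM (M := ℝ) ℝ (⟨x, hx⟩ : Icc (0 : ℝ) (1 / 2))).contDiff.contDiffAt.comp h
      (contDiffAt_realBranch n hh N)
  refine h1.congr_of_eventuallyEq ?_
  filter_upwards [(isOpen_lt continuous_abs continuous_const).mem_nhds hh] with t ht
  exact (realBranch_apply n ht ⟨x, hx⟩).symm

/-! ### Symmetries and lower bounds -/

lemma waveFourier_scale (n : ℕ) (h x : ℝ) :
    waveFourier n h x = n ^ 2 * waveFourier 1 h (n * x) := by
  simp only [waveFourier, Nat.cast_one]
  rw [tsum_congr (fun k : ℕ+ => by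
    rw [show 2 * Real.pi * n * (k : ℝ) * x = 2 * Real.pi * 1 * k * (n * x) by ring])]
  ring

lemma etaFourier_neg (h : ℝ) : etaFourier (-h) = etaFourier h := by
  simp only [etaFourier, pow_mul, neg_sq]

lemma lambdaFourier_neg (n : ℕ) (h : ℝ) : lambdaFourier n (-h) = lambdaFourier n h := by
  simp only [lambdaFourier, pow_mul, neg_sq]

/-- The sign (-1)^k is a shift of the k-th cosine by kπ; this reduces negative h to positive h. -/
lemma waveFourier_one_neg (h x : ℝ) : waveFourier 1 (-h) x = waveFourier 1 h (x + 1 / 2) := by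
  simp only [waveFourier, etaFourier_neg]
  rw [tsum_congr fun k : ℕ+ => ?_]
  have h1 : 2 * Real.pi * ((1 : ℕ) : ℝ) * (k : ℝ) * (x + 1 / 2)
      = 2 * Real.pi * ((1 : ℕ) : ℝ) * k * x + (k : ℕ) * Real.pi := by push_cast; ring
  rw [h1, Real.cos_add_nat_mul_pi, pow_mul (-h), neg_sq, ← pow_mul, neg_pow h]
  ring

lemma waveFourier_one_add_int (h x : ℝ) (j : ℤ) : waveFourier 1 h (x + j) = waveFourier 1 h x := by
  simp only [waveFourier]
  rw [tsum_congr fun k : ℕ+ => ?_]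
  have h1 : 2 * Real.pi * ((1 : ℕ) : ℝ) * (k : ℝ) * (x + j)
      = 2 * Real.pi * ((1 : ℕ) : ℝ) * k * x + ((k * j : ℤ) : ℝ) * (2 * Real.pi) := by
    push_cast; ring
  rw [h1, Real.cos_add_int_mul_two_pi]

lemma waveFourier_one_even (h x : ℝ) : waveFourier 1 h (-x) = waveFourier 1 h x := by
  simp only [waveFourier, mul_neg, Real.cos_neg]

/-- For h ≥ 0 every term of the difference is nonnegative; only k = 1 is kept, with h ≤ h / (1 -
h²). When h > 0, maxima can therefore occur only at integers. -/
lemma waveFourier_one_sub_ge {h : ℝ} (h0 : 0 ≤ h) (h1 : h < 1) (x : ℝ) :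
    8 * Real.pi ^ 2 * h * (1 - Real.cos (2 * Real.pi * x)) ≤
      waveFourier 1 h 0 - waveFourier 1 h x := by
  have hh : |h| < 1 := by rwa [abs_of_nonneg h0]
  set a : ℕ+ → ℝ := fun k => (k : ℝ) * (h ^ (k : ℕ) / (1 - h ^ (2 * (k : ℕ))))
  have ha : ∀ k, 0 ≤ a k := fun k => by
    have : h ^ (2 * (k : ℕ)) ≤ 1 := pow_le_one₀ h0 h1.le
    have : 0 ≤ 1 - h ^ (2 * (k : ℕ)) := by linarith
    positivity
  have hs := (summable_lambert_mul_cos hh 1 0).sub (summable_lambert_mul_cos hh 1 x)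
  have hle := hs.le_tsum 1 fun k _ => by
    rw [← mul_sub]
    refine mul_nonneg (ha k) ?_
    simpa using Real.cos_le_one _
  rw [(summable_lambert_mul_cos hh 1 0).tsum_sub (summable_lambert_mul_cos hh 1 x)] at hle
  have h2 : h ≤ h / (1 - h ^ 2) := by
    rw [le_div_iff₀ (by nlinarith)]
    nlinarith [mul_nonneg h0 (sq_nonneg h)]
  have h3 : 0 ≤ 1 - Real.cos (2 * Real.pi * x) := by linarith [Real.cos_le_one (2 * Real.pi * x)]
  have h4 := mul_le_mul_of_nonneg_right h2 h3
  simp only [PNat.one_coe, Nat.cast_one, mul_one, pow_one, mul_zero, Real.cos_zero, one_mul] at hle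
  simp only [waveFourier, Nat.cast_one, one_mul, mul_one, mul_zero, Real.cos_zero]
  have h5 : 0 < Real.pi ^ 2 := by positivity
  nlinarith

lemma waveFourier_one_half_gap {h : ℝ} (h0 : 0 ≤ h) (h1 : h < 1) :
    16 * Real.pi ^ 2 * h ≤ waveFourier 1 h 0 - waveFourier 1 h (1 / 2) := by
  have h2 := waveFourier_one_sub_ge h0 h1 (1 / 2)
  rw [show 2 * Real.pi * (1 / 2) = Real.pi by ring, Real.cos_pi] at h2
  linarith

lemma lambdaFourier_ge (n : ℕ) {h : ℝ} (hh : |h| < 1) :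
    2 / 3 * (n * Real.pi) ^ 4 * (1 + 240 * h ^ 2) ≤ lambdaFourier n h := by
  have hle := (summable_sigma_mul_pow (𝕜 := ℝ) (z := h) hh).le_tsum 1 fun k _ => by
    rw [pow_mul]; positivity
  simp only [PNat.one_coe, mul_one] at hle
  rw [show ArithmeticFunction.sigma 3 1 = 1 by simp] at hle
  unfold lambdaFourier
  gcongr
  simpa using hle

lemma lambdaFourier_zero (n : ℕ) : lambdaFourier n 0 = 2 / 3 * (n * Real.pi) ^ 4 := by
  simp [lambdaFourier]

lemma waveFourier_zero (n : ℕ) (x : ℝ) : waveFourier n 0 x = 1 / 3 * (n * Real.pi) ^ 2 := by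
  simp [waveFourier, etaFourier, mul_comm]

/-! ### The Fourier expansion of `℘` -/

lemma hasSum_of_eq {ι : Type*} {f g : ι → ℂ} {a : ℂ} (h : ∀ i, f i = g i) (hg : HasSum g a) :
    HasSum f a := by
  rwa [funext h]

/-- `∑ (a + m)⁻²` over the integers `m`. -/
noncomputable def invSqSum (a : ℂ) : ℂ := ∑' m : ℤ, 1 / (a + m) ^ 2

lemma summable_one_div_add_int_sq (a : ℂ) : Summable fun m : ℤ => 1 / (a + m) ^ 2 := by
  simpa using EisensteinSeries.linear_right_summable a 1 (k := 2) le_rfl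

lemma hasSum_invSqSum (a : ℂ) : HasSum (fun m : ℤ => 1 / (a + m) ^ 2) (invSqSum a) :=
  (summable_one_div_add_int_sq a).hasSum

lemma hasSum_invSqSum_sub (a : ℂ) : HasSum (fun m : ℤ => 1 / (a - m) ^ 2) (invSqSum a) := by
  have := (Equiv.neg ℤ).hasSum_iff.mpr (hasSum_invSqSum a)
  simpa [Function.comp_def, sub_eq_add_neg] using this

lemma invSqSum_neg (a : ℂ) : invSqSum (-a) = invSqSum a := by
  refine (hasSum_invSqSum (-a)).unique ?_
  convert hasSum_invSqSum_sub a using 2 with m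
  rw [← neg_sq]; ring_nf

lemma invSqSum_zero : invSqSum 0 = Real.pi ^ 2 / 3 := by
  have h1 := two_mul_riemannZeta_eq_tsum_int_inv_pow_of_even (k := 2) le_rfl even_two
  simp only [invSqSum, zero_add, one_div]
  rw [← h1, Nat.cast_ofNat, riemannZeta_two]
  ring

lemma invSqSum_eq {a : ℂ} (ha : 0 < a.im) :
    invSqSum a = -4 * Real.pi ^ 2 *
      ∑' k : ℕ+, (k : ℂ) * Complex.exp (2 * Real.pi * Complex.I * a) ^ (k : ℕ) := by
  have h1 := EisensteinSeries.qExpansion_identity_pnat (k := 1) le_rfl ⟨a, ha⟩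
  simp only [Nat.reduceAdd, pow_one, Nat.factorial_one, Nat.cast_one, div_one] at h1
  refine h1.trans ?_
  congr 1
  rw [mul_pow, Complex.I_sq]
  ring

/-- Expand 1 / (1 - H^{2k}) as a geometric series in j and exchange the sums; the double series is
dominated by ‖H‖^j · k‖H‖^k. -/
lemma hasSum_lambert_double {H : ℂ} (hH : ‖H‖ < 1) {b : ℕ+ → ℕ} (hb : ∀ k : ℕ+, (k : ℕ) ≤ b k)
    {v : ℕ+ → ℂ} (hv : ∀ k, ‖v k‖ ≤ 1) :
    HasSum (fun j : ℕ => ∑' k : ℕ+, (k : ℂ) * (H ^ b k * (H ^ (2 * (k : ℕ))) ^ j * v k))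
      (∑' k : ℕ+, (k : ℂ) * (H ^ b k / (1 - H ^ (2 * (k : ℕ)))) * v k) := by
  let g : ℕ → ℕ+ → ℂ := fun j k => (k : ℂ) * (H ^ b k * (H ^ (2 * (k : ℕ))) ^ j * v k)
  have hs : Summable (Function.uncurry g) := by
    have h0 : Summable fun p : ℕ × ℕ+ => ‖H‖ ^ p.1 * ((p.2 : ℝ) ^ 1 * ‖H‖ ^ (p.2 : ℕ)) :=
      (summable_geometric_of_lt_one (norm_nonneg H) hH).mul_of_nonneg
        (summable_pnat_pow_mul_geometric 1 (norm_nonneg H) hH) (fun j => by positivity)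
        (fun k => by positivity)
    refine Summable.of_norm_bounded h0 fun ⟨j, k⟩ => ?_
    simp only [Function.uncurry, g, norm_mul, norm_pow, Complex.norm_natCast, pow_one]
    have h1 : ‖H‖ ^ b k ≤ ‖H‖ ^ (k : ℕ) :=
      pow_le_pow_of_le_one (norm_nonneg H) hH.le (hb k)
    have h2 : (‖H‖ ^ (2 * (k : ℕ))) ^ j ≤ ‖H‖ ^ j := by
      rw [← pow_mul]
      exact pow_le_pow_of_le_one (norm_nonneg H) hH.le
        (Nat.le_mul_of_pos_left _ (by positivity))
    calc (k : ℝ) * (‖H‖ ^ b k * (‖H‖ ^ (2 * (k : ℕ))) ^ j * ‖v k‖)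
        ≤ (k : ℝ) * (‖H‖ ^ (k : ℕ) * ‖H‖ ^ j * 1) := by gcongr; exact hv k
      _ = ‖H‖ ^ j * ((k : ℝ) * ‖H‖ ^ (k : ℕ)) := by ring
  have h1 : ∀ k : ℕ+, ∑' j : ℕ, g j k = (k : ℂ) * (H ^ b k / (1 - H ^ (2 * (k : ℕ)))) * v k := by
    intro k
    have h2 : ‖H ^ (2 * (k : ℕ))‖ < 1 := by
      rw [norm_pow]; exact pow_lt_one₀ (norm_nonneg H) hH (by positivity)
    simp only [g]
    rw [tsum_mul_left, tsum_mul_right, tsum_mul_left, tsum_geometric_of_norm_lt_one h2]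
    ring
  rw [← tsum_congr h1, hs.tsum_comm]
  exact hs.prod.hasSum

lemma mem_unitPeriodPair_lattice {τ : ℍ} {z : ℂ} :
    z ∈ (unitPeriodPair τ).lattice ↔ ∃ m n : ℤ, (m : ℂ) + n * τ = z := by
  rw [PeriodPair.mem_lattice]
  simp [unitPeriodPair]

lemma unitPeriodPair_latticeEquivProd_symm (τ : ℍ) (p : ℤ × ℤ) :
    ((unitPeriodPair τ).latticeEquivProd.symm p : ℂ) = p.1 + p.2 * τ := by
  rw [PeriodPair.latticeEquiv_symm_apply]
  simp [unitPeriodPair]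

/-- The lattice sum converges absolutely, so it may be summed over the rows of constant
τ-coefficient. Within a row the two parts converge separately. -/
lemma hasSum_wpFun (τ : ℍ) (z : ℂ) :
    HasSum (fun n : ℤ => invSqSum (z + n * τ) - invSqSum (n * τ)) (wpFun τ z) := by
  have h1 := ((unitPeriodPair τ).latticeEquivProd.symm.toEquiv.hasSum_iff).mpr
    ((unitPeriodPair τ).hasSum_weierstrassP z)
  have h2 := (Equiv.prodComm ℤ ℤ).hasSum_iff.mpr h1
  have h3 : HasSum (fun n : ℤ => invSqSum (z - n * τ) - invSqSum (-(n * τ))) (wpFun τ z) := by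
    refine h2.prod_fiberwise fun n => ?_
    refine hasSum_of_eq (fun m => ?_)
      ((hasSum_invSqSum_sub (z - n * τ)).sub (hasSum_invSqSum_sub (-(n * τ))))
    simp only [Function.comp_apply, Equiv.prodComm_apply, Prod.swap_prod_mk,
      LinearEquiv.coe_toEquiv, unitPeriodPair_latticeEquivProd_symm]
    rw [← neg_sq (m + n * τ : ℂ)]
    ring_nf
  have h4 := (Equiv.neg ℤ).hasSum_iff.mpr h3
  simpa [Function.comp_def] using h4

/-- The complex Fourier expansion of `℘` on the line through the half-period `τ / 2`. -/
lemma wpFun_fourier (τ : ℍ) (x : ℝ) {H : ℂ} (hH : H = Complex.exp (Real.pi * Complex.I * τ)) :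
    wpFun τ (τ / 2 + x) = -8 * Real.pi ^ 2 *
        ∑' k : ℕ+, (k : ℂ) * (H ^ (k : ℕ) / (1 - H ^ (2 * (k : ℕ)))) *
          (Real.cos (2 * Real.pi * k * x) : ℝ) +
      8 * Real.pi ^ 2 * ∑' k : ℕ+, (k : ℂ) * (H ^ (2 * (k : ℕ)) / (1 - H ^ (2 * (k : ℕ)))) -
      Real.pi ^ 2 / 3 := by
  have hτ : 0 < (τ : ℂ).im := τ.im_pos
  have hH1 : ‖H‖ < 1 := by
    rw [hH, Complex.norm_exp, Real.exp_lt_one_iff]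
    have : (Real.pi * Complex.I * τ : ℂ).re = -(Real.pi * (τ : ℂ).im) := by simp
    rw [this]
    have := Real.pi_pos
    nlinarith [mul_pos this hτ]
  have hwave : ∀ s : ℝ, HasSum (fun j : ℕ => invSqSum (τ / 2 + j * τ + s))
      (-4 * Real.pi ^ 2 * ∑' k : ℕ+, (k : ℂ) * (H ^ (k : ℕ) / (1 - H ^ (2 * (k : ℕ)))) *
        Complex.exp ((2 * Real.pi * k * s : ℝ) * Complex.I)) := by
    intro s
    have h1 := (hasSum_lambert_double hH1 (b := fun k => (k : ℕ)) (fun k => le_rfl)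
      (v := fun k => Complex.exp ((2 * Real.pi * k * s : ℝ) * Complex.I))
      (fun k => (Complex.norm_exp_ofReal_mul_I _).le)).mul_left (-4 * Real.pi ^ 2 : ℂ)
    refine hasSum_of_eq (fun j => ?_) h1
    rw [invSqSum_eq (by
      have : 0 < (1 / 2 + j : ℝ) * (τ : ℂ).im := by positivity
      simp; simp at this; linarith)]
    congr 2
    funext k
    congr 1
    rw [hH]
    simp only [← Complex.exp_nat_mul, ← Complex.exp_add]
    congr 1
    push_cast
    ring
  have heven : HasSum (fun j : ℕ => invSqSum ((j + 1 : ℕ) * τ))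
      (-4 * Real.pi ^ 2 *
        ∑' k : ℕ+, (k : ℂ) * (H ^ (2 * (k : ℕ)) / (1 - H ^ (2 * (k : ℕ))))) := by
    have h1 := (hasSum_lambert_double hH1 (b := fun k => 2 * (k : ℕ)) (fun k => by omega)
      (v := fun k => 1) (by simp)).mul_left (-4 * Real.pi ^ 2 : ℂ)
    simp only [mul_one] at h1
    refine hasSum_of_eq (fun j => ?_) h1
    rw [invSqSum_eq (by
      have : 0 < (j + 1 : ℝ) * (τ : ℂ).im := by positivity
      simpa using this)]
    congr 2
    funext k
    congr 1
    rw [hH]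
    simp only [← Complex.exp_nat_mul, ← Complex.exp_add]
    congr 1
    push_cast
    ring
  have heven0 : HasSum (fun j : ℕ => invSqSum (j * τ)) (-4 * Real.pi ^ 2 *
        ∑' k : ℕ+, (k : ℂ) * (H ^ (2 * (k : ℕ)) / (1 - H ^ (2 * (k : ℕ)))) + Real.pi ^ 2 / 3) := by
    -- Row 0 lies on the real axis, where the Lipschitz formula is not available; it contributes
    -- 2ζ(2) = π² / 3.
    have := (hasSum_nat_add_iff (f := fun j : ℕ => invSqSum (j * τ)) 1).mp heven
    simpa [invSqSum_zero] using this
  have hpos := (hwave x).sub heven0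
  have hneg := (hwave (-x)).sub heven
  -- Evenness of `invSqSum` turns row -(j + 1) at x into row j at -x, so the two half-sums carry
  -- conjugate exponentials and add up to cosines.
  have hsum := HasSum.of_nat_of_neg_add_one
    (f := fun n : ℤ => invSqSum (τ / 2 + x + n * τ) - invSqSum (n * τ)) (by
      refine hasSum_of_eq (fun j => ?_) hpos
      push_cast
      ring_nf) (by
      refine hasSum_of_eq (fun j => ?_) hneg
      rw [← invSqSum_neg, ← invSqSum_neg ((-((j : ℤ) + 1) : ℤ) * (τ : ℂ))]
      push_cast
      congr 2 <;> ring)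
  rw [(hasSum_wpFun τ (τ / 2 + x)).unique hsum]
  have hcos : ∑' k : ℕ+, (k : ℂ) * (H ^ (k : ℕ) / (1 - H ^ (2 * (k : ℕ)))) *
        Complex.exp ((2 * Real.pi * k * x : ℝ) * Complex.I) +
      ∑' k : ℕ+, (k : ℂ) * (H ^ (k : ℕ) / (1 - H ^ (2 * (k : ℕ)))) *
        Complex.exp ((2 * Real.pi * k * (-x) : ℝ) * Complex.I) =
      2 * ∑' k : ℕ+, (k : ℂ) * (H ^ (k : ℕ) / (1 - H ^ (2 * (k : ℕ)))) *
          (Real.cos (2 * Real.pi * k * x) : ℝ) := by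
    have hsm : ∀ s : ℝ, Summable fun k : ℕ+ =>
        (k : ℂ) * (H ^ (k : ℕ) / (1 - H ^ (2 * (k : ℕ)))) *
        Complex.exp ((2 * Real.pi * k * s : ℝ) * Complex.I) := fun s =>
      summable_lambert_smul (𝕜 := ℂ) (E := ℂ) (e := fun k => (k : ℕ)) (fun k => le_rfl)
        (fun k => (Complex.norm_exp_ofReal_mul_I _).le) hH1
    rw [← (hsm x).tsum_add (hsm (-x)), ← tsum_mul_left]
    congr 1
    funext k
    rw [mul_neg, Complex.ofReal_neg, Complex.ofReal_cos, Complex.cos]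
    ring
  linear_combination (-4 * (Real.pi : ℂ) ^ 2) * hcos

lemma cexp_pi_mul_I_of_re_eq_zero {τ : ℍ} (hτ : τ.re = 0) :
    ((Real.exp (-Real.pi * τ.im) : ℝ) : ℂ) = Complex.exp (Real.pi * Complex.I * τ) := by
  have h1 : (τ : ℂ) = τ.im * Complex.I := by
    apply Complex.ext <;> simp [hτ]
  rw [h1, Complex.ofReal_exp]
  congr 1
  push_cast
  linear_combination (-(Real.pi : ℂ) * τ.im) * Complex.I_mul_I

lemma neg_wpFun_half_period {τ : ℍ} (hτ : τ.re = 0) (x : ℝ) :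
    -wpFun τ (τ / 2 + x) = waveFourier 1 (Real.exp (-Real.pi * τ.im)) x := by
  rw [wpFun_fourier τ x (cexp_pi_mul_I_of_re_eq_zero hτ)]
  simp only [waveFourier, etaFourier]
  push_cast
  simp only [one_mul, mul_one]
  ring

lemma gTwo_eq {τ : ℍ} (hτ : τ.re = 0) (n : ℕ) :
    1 / 2 * (n : ℂ) ^ 4 * gTwo τ = lambdaFourier n (Real.exp (-Real.pi * τ.im)) := by
  have h1 := tsum_eisSummand_eq_tsum_sigma_mul_cexp_pow (k := 4) (by norm_num)
    (by decide) τ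
  have h2 : (unitPeriodPair τ).G 4 = ∑' v, EisensteinSeries.eisSummand (4 : ℕ) v τ := by
    -- The swap of coordinates is needed because in `eisSummand` the first integer multiplies τ,
    -- while here it multiplies the period 1.
    rw [PeriodPair.G, ← (finTwoArrowEquiv ℤ).symm.tsum_eq,
      ← (unitPeriodPair τ).latticeEquivProd.symm.toEquiv.tsum_eq, ← (Equiv.prodComm ℤ ℤ).tsum_eq]
    refine tsum_congr fun p => ?_
    simp only [LinearEquiv.coe_toEquiv, unitPeriodPair_latticeEquivProd_symm,
      EisensteinSeries.eisSummand, Equiv.prodComm_apply, finTwoArrowEquiv_symm_apply]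
    simp [add_comm]
  rw [gTwo, PeriodPair.g₂, h2, h1, Nat.cast_ofNat, riemannZeta_four]
  have h3 : ∀ k : ℕ+, Complex.exp (2 * Real.pi * Complex.I * τ) ^ (k : ℕ) =
      ((Real.exp (-Real.pi * τ.im) : ℝ) : ℂ) ^ (2 * (k : ℕ)) := fun k => by
    rw [cexp_pi_mul_I_of_re_eq_zero hτ, pow_mul, ← Complex.exp_nat_mul _ 2]
    congr 2
    push_cast
    ring
  simp only [h3, lambdaFourier]
  push_cast
  rw [mul_pow (_ * _) Complex.I, Complex.I_pow_four]
  simp only [show Nat.factorial 3 = 6 from rfl]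
  push_cast
  ring

lemma neg_wpFun_second {τ : ℍ} (hτ : τ.re = 0) (n : ℕ) (x : ℝ) :
    -(n : ℂ) ^ 2 * wpFun τ ((τ : ℂ) / 2 + n * x) =
      waveFourier n (Real.exp (-Real.pi * τ.im)) x := by
  have h1 := neg_wpFun_half_period hτ (n * x)
  rw [waveFourier_scale]
  push_cast at h1 ⊢
  rw [← h1]
  ring

lemma neg_wpFun_third {τ : ℍ} (hτ : τ.re = 0) (n : ℕ) (x : ℝ) :
    -(n : ℂ) ^ 2 * wpFun τ (1 / 2 + (τ : ℂ) / 2 + n * x) =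
      waveFourier n (-Real.exp (-Real.pi * τ.im)) x := by
  have h1 := neg_wpFun_half_period hτ (n * x + 1 / 2)
  rw [waveFourier_scale, waveFourier_one_neg]
  push_cast at h1 ⊢
  rw [← h1, show (1 / 2 + (τ : ℂ) / 2 + n * x) = τ / 2 + (n * x + 1 / 2) by ring]
  ring

/-! ### The differential equation -/

lemma hasDerivAt_of_eq {f g : ℝ → ℝ} {f' g' x : ℝ} (hg : HasDerivAt g g' x) (h : ∀ t, f t = g t)
    (h' : f' = g') : HasDerivAt f f' x := by
  rwa [funext h, h']

lemma notMem_lattice_of_im {τ : ℍ} {z : ℂ} (h0 : 0 < z.im) (h1 : z.im < (τ : ℂ).im) :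
    z ∉ (unitPeriodPair τ).lattice := by
  rw [mem_unitPeriodPair_lattice]
  rintro ⟨m, n, rfl⟩
  simp only [Complex.add_im, Complex.intCast_im, zero_add, Complex.mul_im, Complex.intCast_re,
    zero_mul, add_zero] at h0 h1
  have hτ : 0 < (τ : ℂ).im := τ.im_pos
  have h2 : 0 < n := by
    by_contra! h
    have : (n : ℝ) ≤ 0 := by exact_mod_cast h
    nlinarith
  have h3 : (1 : ℝ) ≤ n := by exact_mod_cast h2
  nlinarith

lemma line_notMem_lattice (τ : ℍ) (x : ℝ) : (τ : ℂ) / 2 + x ∉ (unitPeriodPair τ).lattice := by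
  have hτ : 0 < (τ : ℂ).im := τ.im_pos
  apply notMem_lattice_of_im <;> simp at hτ ⊢ <;> linarith

lemma PeriodPair.hasDerivAt_weierstrassP (L : PeriodPair) {z : ℂ} (hz : z ∉ L.lattice) :
    HasDerivAt L.weierstrassP (L.derivWeierstrassP z) z := by
  rw [← L.deriv_weierstrassP]
  exact (L.differentiableOn_weierstrassP.differentiableAt
    (L.isClosed_lattice.isOpen_compl.mem_nhds hz)).hasDerivAt

lemma PeriodPair.hasDerivAt_derivWeierstrassP (L : PeriodPair) {z : ℂ} (hz : z ∉ L.lattice) :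
    HasDerivAt L.derivWeierstrassP (deriv L.derivWeierstrassP z) z :=
  (L.differentiableOn_derivWeierstrassP.differentiableAt
    (L.isClosed_lattice.isOpen_compl.mem_nhds hz)).hasDerivAt

/-- The differentiated Weierstrass equation, multiplied by `℘'`. -/
lemma PeriodPair.derivWeierstrassP_mul_eq_zero (L : PeriodPair) {z : ℂ} (hz : z ∉ L.lattice) :
    L.derivWeierstrassP z *
      (deriv L.derivWeierstrassP z - (6 * L.weierstrassP z ^ 2 - L.g₂ / 2)) = 0 := by
  have h1 := (L.hasDerivAt_derivWeierstrassP hz).pow 2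
  have h2 := ((((L.hasDerivAt_weierstrassP hz).pow 3).const_mul 4).sub
    ((L.hasDerivAt_weierstrassP hz).const_mul L.g₂)).sub_const L.g₃
  have h3 := h2.congr_of_eventuallyEq (f₁ := L.derivWeierstrassP ^ 2) (by
    filter_upwards [L.isClosed_lattice.isOpen_compl.mem_nhds hz] with w hw
    simpa using L.derivWeierstrassP_sq w hw)
  have h4 := h1.unique h3
  push_cast at h4
  linear_combination h4 / 2

lemma reCast_eq {z : ℂ} {r : ℝ} (h : z = r) : z.re = r := by rw [h, Complex.ofReal_re]

lemma exists_upperHalfPlane {h : ℝ} (h0 : 0 < h) (h1 : h < 1) :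
    ∃ τ : ℍ, τ.re = 0 ∧ Real.exp (-Real.pi * τ.im) = h := by
  have hl : 0 < -Real.log h / Real.pi := div_pos (by linarith [Real.log_neg h0 h1]) Real.pi_pos
  refine ⟨⟨⟨0, -Real.log h / Real.pi⟩, hl⟩, rfl, ?_⟩
  change Real.exp (-Real.pi * (-Real.log h / Real.pi)) = h
  have := Real.pi_ne_zero
  rw [show -Real.pi * (-Real.log h / Real.pi) = Real.log h by field_simp, Real.exp_log h0]

lemma exp_neg_pi_mul_im_mem (τ : ℍ) : Real.exp (-Real.pi * τ.im) ∈ Ioo (0 : ℝ) 1 := by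
  refine ⟨Real.exp_pos _, ?_⟩
  rw [Real.exp_lt_one_iff]
  nlinarith [mul_pos Real.pi_pos τ.im_pos]

/-- Differentiating the cubic equation gives the claim only after cancelling `℘'`. On the connected,
lattice-free strip 0 < Im z < Im τ one of the two analytic factors vanishes identically; it cannot
be `℘'`, since the wave on the central line is not constant. -/
lemma deriv_derivWeierstrassP_line {τ : ℍ} (hτ : τ.re = 0) (x : ℝ) :
    deriv (unitPeriodPair τ).derivWeierstrassP (τ / 2 + x) =
      6 * wpFun τ (τ / 2 + x) ^ 2 - gTwo τ / 2 := by
  set L := unitPeriodPair τ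
  set S : Set ℂ := {z | z.im ∈ Ioo 0 (τ : ℂ).im}
  have hτ0 : 0 < (τ : ℂ).im := τ.im_pos
  have hS : S ⊆ (L.lattice : Set ℂ)ᶜ := fun z hz => notMem_lattice_of_im hz.1 hz.2
  have hconn : IsPreconnected S :=
    ((convex_Ioo (0 : ℝ) (τ : ℂ).im).linear_preimage Complex.imLm).isPreconnected
  have hline : ∀ x : ℝ, (τ : ℂ) / 2 + x ∈ S := fun x => by
    change 0 < ((τ : ℂ) / 2 + x).im ∧ ((τ : ℂ) / 2 + x).im < (τ : ℂ).im
    constructor <;> simp at hτ0 ⊢ <;> linarith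
  have hA := L.analyticOnNhd_derivWeierstrassP.mono hS
  have hB : AnalyticOnNhd ℂ (fun z => deriv L.derivWeierstrassP z -
      (6 * L.weierstrassP z ^ 2 - L.g₂ / 2)) S :=
    hA.deriv.sub (((L.analyticOnNhd_weierstrassP.mono hS).pow 2 |>.const_smul (c := (6 : ℂ))).sub
      analyticOnNhd_const)
  rcases hA.eq_zero_or_eq_zero_of_mul_eq_zero hB
    (fun z hz => L.derivWeierstrassP_mul_eq_zero (hS hz)) hconn with h | h
  · exfalso
    have hd : ∀ y : ℝ, HasDerivAt (waveFourier 1 (Real.exp (-Real.pi * τ.im))) 0 y := fun y => by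
      have h1 : HasDerivAt (fun z : ℂ => -L.weierstrassP (τ / 2 + z)) 0 y := by
        have := ((L.hasDerivAt_weierstrassP (line_notMem_lattice τ y)).comp_const_add
          (τ / 2 : ℂ) (y : ℂ)).neg
        rw [h _ (hline y), neg_zero] at this
        exact this
      have h2 := h1.real_of_complex
      rw [Complex.zero_re] at h2
      exact hasDerivAt_of_eq h2 (fun t => (reCast_eq (neg_wpFun_half_period hτ t)).symm) rfl
    have h3 := is_const_of_deriv_eq_zero (fun y => (hd y).differentiableAt) (fun y => (hd y).deriv)
      0 (1 / 2)
    have hm := exp_neg_pi_mul_im_mem τ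
    have h4 := waveFourier_one_half_gap hm.1.le hm.2
    rw [h3, sub_self] at h4
    have : 0 < 16 * Real.pi ^ 2 * Real.exp (-Real.pi * τ.im) := by positivity
    linarith
  · exact sub_eq_zero.mp (h _ (hline x))

lemma lambdaFourier_scale (n : ℕ) (h : ℝ) : lambdaFourier n h = n ^ 4 * lambdaFourier 1 h := by
  simp only [lambdaFourier, Nat.cast_one]
  ring

lemma exists_wave_deriv_of_pos {h : ℝ} (h0 : 0 < h) (h1 : h < 1) :
    ∃ p' : ℝ → ℝ, (∀ x, HasDerivAt (waveFourier 1 h) (p' x) x) ∧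
      ∀ x, HasDerivAt p' (lambdaFourier 1 h - 6 * waveFourier 1 h x ^ 2) x := by
  obtain ⟨τ, hτ, rfl⟩ := exists_upperHalfPlane h0 h1
  set L := unitPeriodPair τ
  refine ⟨fun x => (-L.derivWeierstrassP (τ / 2 + x)).re, fun x => ?_, fun x => ?_⟩
  · have h2 : HasDerivAt (fun z : ℂ => -L.weierstrassP (τ / 2 + z))
        (-L.derivWeierstrassP (τ / 2 + x)) x :=
      ((L.hasDerivAt_weierstrassP (line_notMem_lattice τ x)).comp_const_add _ _).neg
    exact hasDerivAt_of_eq h2.real_of_complex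
      (fun t => (reCast_eq (neg_wpFun_half_period hτ t)).symm) rfl
  · have h2 : HasDerivAt (fun z : ℂ => -L.derivWeierstrassP (τ / 2 + z))
        (-deriv L.derivWeierstrassP (τ / 2 + x)) x :=
      ((L.hasDerivAt_derivWeierstrassP (line_notMem_lattice τ x)).comp_const_add _ _).neg
    refine hasDerivAt_of_eq h2.real_of_complex (fun t => rfl) ?_
    symm
    apply reCast_eq
    rw [deriv_derivWeierstrassP_line hτ]
    have h3 := neg_wpFun_half_period hτ x
    have h4 := gTwo_eq hτ 1
    push_cast at h4 ⊢
    rw [← h3, ← h4]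
    ring

lemma exists_wave_deriv (n : ℕ) {h : ℝ} (hh : |h| < 1) :
    ∃ p' : ℝ → ℝ, (∀ x, HasDerivAt (waveFourier n h) (p' x) x) ∧
      ∀ x, HasDerivAt p' (lambdaFourier n h - 6 * waveFourier n h x ^ 2) x := by
  have key : ∃ p' : ℝ → ℝ, (∀ x, HasDerivAt (waveFourier 1 h) (p' x) x) ∧
      ∀ x, HasDerivAt p' (lambdaFourier 1 h - 6 * waveFourier 1 h x ^ 2) x := by
    rcases lt_trichotomy h 0 with h0 | rfl | h0
    · obtain ⟨p', hp, hp'⟩ := exists_wave_deriv_of_pos (h := -h) (by linarith)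
        (by linarith [neg_abs_le h])
      refine ⟨fun x => p' (x + 1 / 2), fun x => ?_, fun x => ?_⟩
      · refine hasDerivAt_of_eq ((hp (x + 1 / 2)).comp_add_const x (1 / 2)) (fun t => ?_) rfl
        rw [← waveFourier_one_neg, neg_neg]
      · refine hasDerivAt_of_eq ((hp' (x + 1 / 2)).comp_add_const x (1 / 2)) (fun t => rfl) ?_
        rw [← waveFourier_one_neg, neg_neg, lambdaFourier_neg]
    · refine ⟨fun _ => 0, fun x => ?_, fun x => ?_⟩
      · rw [show waveFourier 1 0 = fun _ => 1 / 3 * ((1 : ℕ) * Real.pi) ^ 2 from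
          funext (waveFourier_zero 1)]
        exact hasDerivAt_const _ _
      · refine hasDerivAt_of_eq (hasDerivAt_const x (0 : ℝ)) (fun t => rfl) ?_
        rw [waveFourier_zero, lambdaFourier_zero]
        ring
    · exact exists_wave_deriv_of_pos h0 (lt_of_abs_lt hh)
  obtain ⟨p', hp, hp'⟩ := key
  have hlin : ∀ x : ℝ, HasDerivAt (fun x : ℝ => n * x) n x := fun x => by
    simpa using (hasDerivAt_id x).const_mul (n : ℝ)
  refine ⟨fun x => n ^ 3 * p' (n * x), fun x => ?_, fun x => ?_⟩
  · exact hasDerivAt_of_eq (((hp (n * x)).comp x (hlin x)).const_mul ((n : ℝ) ^ 2))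
      (fun t => waveFourier_scale n h t) (by ring)
  · refine hasDerivAt_of_eq (((hp' (n * x)).comp x (hlin x)).const_mul ((n : ℝ) ^ 3))
      (fun t => rfl) ?_
    rw [waveFourier_scale, lambdaFourier_scale]
    ring

/-- The derivative at a centre of symmetry equals its own negative. -/
lemma HasDerivAt.eq_zero_of_reflection {f : ℝ → ℝ} {f' a : ℝ} (hf : HasDerivAt f f' a)
    (hs : ∀ x, f (2 * a - x) = f x) : f' = 0 := by
  have h1 : HasDerivAt (fun x => f (2 * a - x)) (-f') a :=
    HasDerivAt.comp_const_sub (2 * a) a (by rwa [show 2 * a - a = a by ring])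
  rw [funext hs] at h1
  linarith [h1.unique hf]

lemma waveFourier_reflect_zero (n : ℕ) (h x : ℝ) :
    waveFourier n h (2 * 0 - x) = waveFourier n h x := by
  rw [waveFourier_scale, waveFourier_scale n h x, ← waveFourier_one_even]
  ring_nf

lemma waveFourier_reflect_half (n : ℕ) (h x : ℝ) :
    waveFourier n h (2 * (1 / 2) - x) = waveFourier n h x := by
  rw [waveFourier_scale, waveFourier_scale n h x, ← waveFourier_one_even h (n * x),
    ← waveFourier_one_add_int h (-(n * x)) n]
  push_cast
  ring_nf

/-! ### Modular inversion and surjectivity onto the admissible amplitudes -/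

/-- Multiplication by τ carries ℤ + ℤσ onto ℤ + ℤτ, because τσ = -1, and `℘` is homogeneous of
degree -2. The bijection of indices is (a, b) ↦ (b, -a). -/
lemma wpFun_inversion {τ σ : ℍ} (hσ : (σ : ℂ) * τ = -1) (z : ℂ) :
    wpFun σ z = (τ : ℂ) ^ 2 * wpFun τ (τ * z) := by
  have hτ0 : (τ : ℂ) ≠ 0 := τ.ne_zero
  have hrep : ∀ (τ : ℍ) (z : ℂ), wpFun τ z =
      ∑' p : ℤ × ℤ, (1 / (z - (p.1 + p.2 * τ)) ^ 2 - 1 / (p.1 + p.2 * τ : ℂ) ^ 2) := by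
    intro τ z
    rw [wpFun, PeriodPair.weierstrassP,
      ← (unitPeriodPair τ).latticeEquivProd.symm.toEquiv.tsum_eq]
    simp only [LinearEquiv.coe_toEquiv, unitPeriodPair_latticeEquivProd_symm]
  rw [hrep, hrep, ← tsum_mul_left,
    ← ((Equiv.neg ℤ).prodCongr (Equiv.refl ℤ) |>.trans (Equiv.prodComm ℤ ℤ)).tsum_eq]
  refine tsum_congr fun p => ?_
  have h1 : ∀ w : ℂ, (τ : ℂ) ^ 2 * (1 / (τ * w) ^ 2) = 1 / w ^ 2 := fun w => by
    rw [mul_pow, one_div, mul_inv, ← mul_assoc, mul_inv_cancel₀ (pow_ne_zero 2 hτ0), one_mul,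
      one_div]
  simp only [Equiv.trans_apply, Equiv.prodCongr_apply, Equiv.prodComm_apply, Prod.map,
    Equiv.neg_apply, Equiv.refl_apply, Prod.swap_prod_mk]
  push_cast
  rw [mul_sub, ← h1 (z - _), ← h1 (_ + -(p.1 : ℂ) * σ)]
  have h2 : (τ : ℂ) * (p.2 + -p.1 * σ) = p.1 + p.2 * τ := by
    linear_combination (-(p.1 : ℂ)) * hσ
  rw [mul_sub (τ : ℂ) z, h2]

/-- `℘'` is odd and periodic, hence zero at half-periods. -/
lemma PeriodPair.half_period_root (L : PeriodPair) {z : ℂ} (hz : z ∉ L.lattice)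
    (h2 : z + z ∈ L.lattice) :
    4 * L.weierstrassP z ^ 3 - L.g₂ * L.weierstrassP z - L.g₃ = 0 := by
  have h3 := L.derivWeierstrassP_sub_coe z ⟨z + z, h2⟩
  have h4 : z - (z + z) = -z := by ring
  simp only [h4, L.derivWeierstrassP_neg] at h3
  have h5 : L.derivWeierstrassP z = 0 := by linear_combination (-1 / 2 : ℂ) * h3
  rw [← L.derivWeierstrassP_sq z hz, h5]
  ring

/-- Vieta: the cubic has no quadratic term. -/
lemma sum_eq_zero_of_roots {a b c g₂ g₃ : ℂ} (hab : a ≠ b) (hbc : b ≠ c) (hac : a ≠ c)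
    (ha : 4 * a ^ 3 - g₂ * a - g₃ = 0) (hb : 4 * b ^ 3 - g₂ * b - g₃ = 0)
    (hc : 4 * c ^ 3 - g₂ * c - g₃ = 0) : a + b + c = 0 := by
  have h1 : 4 * (a ^ 2 + a * b + b ^ 2) - g₂ = 0 := by
    apply mul_left_cancel₀ (sub_ne_zero.mpr hab); linear_combination ha - hb
  have h2 : 4 * (a ^ 2 + a * c + c ^ 2) - g₂ = 0 := by
    apply mul_left_cancel₀ (sub_ne_zero.mpr hac); linear_combination ha - hc
  apply mul_left_cancel₀ (sub_ne_zero.mpr hbc); linear_combination (h1 - h2) / 4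

lemma waveFourier_one_half_lt {h : ℝ} (h0 : 0 < h) (h1 : h < 1) :
    waveFourier 1 h (1 / 2) < waveFourier 1 h 0 := by
  have := waveFourier_one_half_gap h0.le h1
  have : 0 < 16 * Real.pi ^ 2 * h := by positivity
  linarith

/-- Here h' belongs to -1/τ and c = (Im τ)². Inversion swaps the half-periods 1/2 and τ/2, up to
sign and scaling, and fixes the third modulo the lattice; `℘(1/2)` is then eliminated through e₁ +
e₂ + e₃ = 0. The ratio (M - m)/(2M + m) thereby turns into one minus itself. -/
lemma exists_inversion {h : ℝ} (h0 : 0 < h) (h1 : h < 1) :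
    ∃ h' ∈ Ioo (0 : ℝ) 1, ∃ c > 0,
      waveFourier 1 h' 0 = c * (waveFourier 1 h 0 + waveFourier 1 h (1 / 2)) ∧
      waveFourier 1 h' (1 / 2) = -c * waveFourier 1 h (1 / 2) := by
  have hlt := waveFourier_one_half_lt h0 h1
  obtain ⟨τ, hτ, rfl⟩ := exists_upperHalfPlane h0 h1
  have hθ : 0 < τ.im := τ.im_pos
  have hτI : (τ : ℂ) = τ.im * Complex.I := by apply Complex.ext <;> simp [hτ]
  have hτ2 : (τ : ℂ) ^ 2 = -(τ.im : ℂ) ^ 2 := by rw [hτI, mul_pow, Complex.I_sq]; simp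
  let σ : ℍ := ⟨⟨0, τ.im⁻¹⟩, inv_pos.mpr hθ⟩
  have hσ : σ.re = 0 := rfl
  have hσI : (σ : ℂ) = (τ.im : ℂ)⁻¹ * Complex.I := by
    apply Complex.ext <;> simp [σ, ← Complex.ofReal_inv]
  have hστ : (σ : ℂ) * τ = -1 := by
    have : (τ.im : ℂ) ≠ 0 := by exact_mod_cast hθ.ne'
    rw [hσI, hτI]
    field_simp
    exact Complex.I_sq
  have hm := exp_neg_pi_mul_im_mem σ
  have hlt' := waveFourier_one_half_lt hm.1 hm.2
  set h := Real.exp (-Real.pi * τ.im)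
  set h' := Real.exp (-Real.pi * σ.im)
  have hM' : (waveFourier 1 h' 0 : ℂ) = (τ.im : ℂ) ^ 2 * wpFun τ (1 / 2) := by
    rw [← neg_wpFun_half_period hσ, wpFun_inversion hστ, hτ2,
      show (τ : ℂ) * (σ / 2 + (0 : ℝ)) = -(1 / 2) by push_cast; linear_combination hστ / 2]
    rw [wpFun, PeriodPair.weierstrassP_neg, ← wpFun]
    ring
  have hm' : (waveFourier 1 h' (1 / 2) : ℂ) = ((-τ.im ^ 2 * waveFourier 1 h (1 / 2) : ℝ) : ℂ) := by
    rw [← neg_wpFun_half_period hσ, wpFun_inversion hστ, hτ2,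
      show (τ : ℂ) * (σ / 2 + (1 / 2 : ℝ)) = τ / 2 + (-(1 / 2) : ℝ) by
        push_cast; linear_combination hστ / 2]
    have := neg_wpFun_half_period hτ (-(1 / 2))
    rw [waveFourier_one_even] at this
    push_cast at this ⊢
    rw [← this]
    ring
  have hm'' := Complex.ofReal_injective hm'
  refine ⟨h', hm, τ.im ^ 2, by positivity, ?_, hm''⟩
  have hroot : ∀ z : ℂ, z ∉ (unitPeriodPair τ).lattice → z + z ∈ (unitPeriodPair τ).lattice →
      4 * wpFun τ z ^ 3 - gTwo τ * wpFun τ z - (unitPeriodPair τ).g₃ = 0 :=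
    fun z hz h2 => (unitPeriodPair τ).half_period_root hz h2
  have hθ2 : 0 < τ.im ^ 2 := by positivity
  set e : ℝ := waveFourier 1 h' 0 / τ.im ^ 2
  have he : wpFun τ (1 / 2) = (e : ℂ) := by
    have : (τ.im : ℂ) ≠ 0 := by exact_mod_cast hθ.ne'
    simp only [e]
    rw [Complex.ofReal_div, hM']
    push_cast
    field_simp
  have r1 := hroot (1 / 2) (unitPeriodPair τ).ω₁_div_two_notMem_lattice
    (mem_unitPeriodPair_lattice.mpr ⟨1, 0, by push_cast; ring⟩)
  have r2 := hroot (τ / 2 + (0 : ℝ)) (line_notMem_lattice τ 0)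
    (mem_unitPeriodPair_lattice.mpr ⟨0, 1, by push_cast; ring⟩)
  have r3 := hroot (τ / 2 + (1 / 2 : ℝ)) (line_notMem_lattice τ _)
    (mem_unitPeriodPair_lattice.mpr ⟨1, 1, by push_cast; ring⟩)
  have e2 : wpFun τ (τ / 2 + (0 : ℝ)) = ((-waveFourier 1 h 0 : ℝ) : ℂ) := by
    rw [Complex.ofReal_neg, ← neg_wpFun_half_period hτ, neg_neg]
  have e3 : wpFun τ (τ / 2 + (1 / 2 : ℝ)) = ((-waveFourier 1 h (1 / 2) : ℝ) : ℂ) := by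
    rw [Complex.ofReal_neg, ← neg_wpFun_half_period hτ, neg_neg]
  rw [he] at r1
  rw [e2] at r2
  rw [e3] at r3
  have hgt : -waveFourier 1 h (1 / 2) < e := by
    rw [hm''] at hlt'
    simp only [e]
    rw [lt_div_iff₀ hθ2]
    linarith
  have hsum := sum_eq_zero_of_roots
    (fun H => by have := Complex.ofReal_injective H; linarith)
    (fun H => by have := Complex.ofReal_injective H; linarith)
    (fun H => by have := Complex.ofReal_injective H; linarith) r1 r2 r3
  have hsum' : e + -waveFourier 1 h 0 + -waveFourier 1 h (1 / 2) = 0 := by exact_mod_cast hsum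
  have : waveFourier 1 h' 0 = τ.im ^ 2 * e := by simp only [e]; field_simp
  rw [this]
  linear_combination τ.im ^ 2 * hsum'

/-- This is the inequality m' < M' for the inverted wave. -/
lemma waveFourier_amplitude_pos {h : ℝ} (h0 : 0 < h) (h1 : h < 1) :
    0 < waveFourier 1 h 0 + 2 * waveFourier 1 h (1 / 2) := by
  obtain ⟨h', hm, c, hc, hM, hmm⟩ := exists_inversion h0 h1
  have := waveFourier_one_half_lt hm.1 hm.2
  rw [hM, hmm] at this
  by_contra! hle
  nlinarith

/-- Intermediate value theorem. A point where the ratio is below r lies near h = 0; a point where it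
exceeds r is the inversion of one where it is below 1 - r, so no asymptotics at h = 1 are needed. -/
lemma exists_amplitude_ratio {r : ℝ} (hr : r ∈ Ioo (0 : ℝ) 1) :
    ∃ h ∈ Ioo (0 : ℝ) 1, waveFourier 1 h 0 - waveFourier 1 h (1 / 2) =
      r * (2 * waveFourier 1 h 0 + waveFourier 1 h (1 / 2)) := by
  let φ : ℝ → ℝ → ℝ := fun r h => (waveFourier 1 h 0 - waveFourier 1 h (1 / 2)) -
      r * (2 * waveFourier 1 h 0 + waveFourier 1 h (1 / 2))
  have hcont : ∀ r h, |h| < 1 → ContinuousAt (φ r) h := fun r h hh => by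
    have c0 := (contDiffAt_waveFourier 1 hh (x := 0) (by norm_num) 0).continuousAt
    have c1 := (contDiffAt_waveFourier 1 hh (x := 1 / 2) (by norm_num) 0).continuousAt
    exact (c0.sub c1).sub (continuousAt_const.mul ((continuousAt_const.mul c0).add c1))
  have hneg : ∀ r, 0 < r → ∃ h ∈ Ioo (0 : ℝ) 1, φ r h < 0 := fun r hr => by
    have h0 : φ r 0 < 0 := by
      simp only [φ, waveFourier_zero]
      have : 0 < Real.pi ^ 2 := by positivity
      push_cast
      nlinarith
    have h1 := ((hcont r 0 (by simp)).eventually_lt_const h0).filter_mono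
      (nhdsWithin_le_nhds (s := Ioi 0))
    obtain ⟨h, hlt, hmem⟩ := (h1.and (Ioo_mem_nhdsGT one_pos)).exists
    exact ⟨h, hmem, hlt⟩
  obtain ⟨a, ha, hφa⟩ := hneg r hr.1
  obtain ⟨b, hb, hφb⟩ := hneg (1 - r) (by linarith [hr.2])
  obtain ⟨b', hb', c, hc, hM, hm⟩ := exists_inversion hb.1 hb.2
  have hφb' : 0 < φ r b' := by
    simp only [φ, hM, hm] at hφb ⊢
    nlinarith
  obtain ⟨h, hh, hφ⟩ := isPreconnected_Ioo.intermediate_value ha hb' (f := φ r)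
    (fun h hh => (hcont r h (abs_lt.mpr ⟨by linarith [hh.1], hh.2⟩)).continuousWithinAt)
    (mem_Icc.mpr ⟨hφa.le, hφb'.le⟩)
  exact ⟨h, hh, by simpa only [φ, sub_eq_zero] using hφ⟩

/-- Every admissible pair of extreme values is attained by a rescaled wave. -/
lemma exists_wave_of_extremes {m M : ℝ} (hmM : m < M) (hpos : 0 < M + 2 * m) :
    ∃ h ∈ Ioo (0 : ℝ) 1, ∃ c > 0, M = c ^ 2 * waveFourier 1 h 0 ∧
      m = c ^ 2 * waveFourier 1 h (1 / 2) := by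
  have hD : 0 < 2 * M + m := by linarith
  obtain ⟨h, hh, hr⟩ := exists_amplitude_ratio (r := (M - m) / (2 * M + m))
    ⟨div_pos (by linarith) hD, by rw [div_lt_one hD]; linarith⟩
  have h1 := waveFourier_one_half_lt hh.1 hh.2
  have h2 := waveFourier_amplitude_pos hh.1 hh.2
  set A := waveFourier 1 h 0
  set B := waveFourier 1 h (1 / 2)
  have hE : 0 < 2 * A + B := by linarith
  -- The ratios already agree, so it is enough for the scaling to match 2M + m.
  refine ⟨h, hh, √((2 * M + m) / (2 * A + B)), Real.sqrt_pos.mpr (div_pos hD hE), ?_⟩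
  rw [Real.sq_sqrt (div_pos hD hE).le]
  rw [div_mul_eq_mul_div, eq_div_iff hD.ne'] at hr
  constructor <;> field_simp <;> nlinarith

/-! ### Solutions of `W'' + 6 W² = lam` as solutions of a first-order system -/

/-- `W` and `V = W'` are continuous on `[a, b]` and solve `W'' + 6 W² = lam` on `(a, b)`. -/
structure SolvesOn (lam : ℝ) (W V : ℝ → ℝ) (a b : ℝ) : Prop where
  cont : ContinuousOn W (Icc a b)
  cont_deriv : ContinuousOn V (Icc a b)
  hasDerivAt : ∀ x ∈ Ioo a b, HasDerivAt W (V x) x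
  hasDerivAt_deriv : ∀ x ∈ Ioo a b, HasDerivAt V (lam - 6 * W x ^ 2) x

lemma SolvesOn.of_hasDerivAt {lam : ℝ} {W V : ℝ → ℝ} (h1 : ∀ x, HasDerivAt W (V x) x)
    (h2 : ∀ x, HasDerivAt V (lam - 6 * W x ^ 2) x) (a b : ℝ) : SolvesOn lam W V a b :=
  ⟨fun x _ => (h1 x).continuousAt.continuousWithinAt,
    fun x _ => (h2 x).continuousAt.continuousWithinAt, fun x _ => h1 x, fun x _ => h2 x⟩

/-- Grönwall in both directions: D·exp(-Kx) decreases to the right of t, and D·exp(Kx) increases up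
to t from the left. -/
lemma eq_zero_of_abs_deriv_le {D D' : ℝ → ℝ} {K a b t : ℝ} (ht : t ∈ Icc a b)
    (hc : ContinuousOn D (Icc a b)) (hd : ∀ x ∈ Ioo a b, HasDerivAt D (D' x) x)
    (hD : ∀ x ∈ Icc a b, 0 ≤ D x) (hK : ∀ x ∈ Ioo a b, |D' x| ≤ K * D x) (h0 : D t = 0)
    {x : ℝ} (hx : x ∈ Icc a b) : D x = 0 := by
  have hexp : ∀ s x : ℝ, HasDerivAt (fun x => Real.exp (s * x)) (s * Real.exp (s * x)) x :=
    fun s x => by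
      have := ((hasDerivAt_id x).const_mul s).exp
      simp only [id, mul_one] at this
      rwa [mul_comm] at this
  have hcont : ∀ s : ℝ, ContinuousOn (fun x => D x * Real.exp (s * x)) (Icc a b) :=
    fun s => hc.mul (by fun_prop)
  have hder : ∀ s : ℝ, ∀ x ∈ interior (Icc a b),
      HasDerivAt (fun x => D x * Real.exp (s * x)) ((D' x + s * D x) * Real.exp (s * x)) x := by
    intro s x hx
    rw [interior_Icc] at hx
    exact hasDerivAt_of_eq ((hd x hx).mul (hexp s x)) (fun _ => rfl) (by ring)
  refine le_antisymm ?_ (hD x hx)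
  rcases le_total t x with htx | hxt
  · have hanti : AntitoneOn (fun x => D x * Real.exp (-K * x)) (Icc a b) := by
      refine antitoneOn_of_deriv_nonpos (convex_Icc a b) (hcont _)
        (fun x hx => (hder _ x hx).differentiableAt.differentiableWithinAt) fun x hx => ?_
      rw [(hder _ x hx).deriv]
      rw [interior_Icc] at hx
      have := (abs_le.mp (hK x hx)).2
      exact mul_nonpos_of_nonpos_of_nonneg (by linarith) (Real.exp_pos _).le
    have h1 := hanti ht hx htx
    simp only [h0, zero_mul] at h1
    exact nonpos_of_mul_nonpos_left h1 (Real.exp_pos _)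
  · have hmono : MonotoneOn (fun x => D x * Real.exp (K * x)) (Icc a b) := by
      refine monotoneOn_of_deriv_nonneg (convex_Icc a b) (hcont _)
        (fun x hx => (hder _ x hx).differentiableAt.differentiableWithinAt) fun x hx => ?_
      rw [(hder _ x hx).deriv]
      rw [interior_Icc] at hx
      have := (abs_le.mp (hK x hx)).1
      exact mul_nonneg (by linarith) (Real.exp_pos _).le
    have h1 := hmono hx ht hxt
    simp only [h0, zero_mul] at h1
    exact nonpos_of_mul_nonpos_left h1 (Real.exp_pos _)

lemma SolvesOn.unique {lam : ℝ} {W V U Y : ℝ → ℝ} {a b t : ℝ} (hW : SolvesOn lam W V a b)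
    (hU : SolvesOn lam U Y a b) (ht : t ∈ Icc a b) (h0 : W t = U t) (h1 : V t = Y t) {x : ℝ}
    (hx : x ∈ Icc a b) : W x = U x ∧ V x = Y x := by
  obtain ⟨C, hC⟩ := isCompact_Icc.exists_bound_of_continuousOn (hW.cont.add hU.cont)
  have hC0 : 0 ≤ C := (norm_nonneg _).trans (hC t ht)
  -- D is the squared distance in the phase plane; its derivative factors because W² - U² = (W -
  -- U)(W + U), and C bounds |W + U|.
  have key := eq_zero_of_abs_deriv_le (D := fun x => (W x - U x) ^ 2 + (V x - Y x) ^ 2)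
    (D' := fun x => 2 * (W x - U x) * (V x - Y x) * (1 - 6 * (W x + U x)))
    (K := 1 + 6 * C) ht
    (((hW.cont.sub hU.cont).pow 2).add ((hW.cont_deriv.sub hU.cont_deriv).pow 2))
    (fun x hx => hasDerivAt_of_eq
      ((((hW.hasDerivAt x hx).sub (hU.hasDerivAt x hx)).pow 2).add
        (((hW.hasDerivAt_deriv x hx).sub (hU.hasDerivAt_deriv x hx)).pow 2))
      (fun _ => rfl) (by push_cast; simp only [Pi.sub_apply]; ring))
    (fun x _ => by positivity)
    (fun x hx => ?_) (by simp [h0, h1]) hx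
  · have h2 : (W x - U x) ^ 2 = 0 ∧ (V x - Y x) ^ 2 = 0 :=
      (add_eq_zero_iff_of_nonneg (sq_nonneg _) (sq_nonneg _)).mp key
    exact ⟨sub_eq_zero.mp (pow_eq_zero_iff two_ne_zero |>.mp h2.1),
      sub_eq_zero.mp (pow_eq_zero_iff two_ne_zero |>.mp h2.2)⟩
  · have h3 : |1 - 6 * (W x + U x)| ≤ 1 + 6 * C := by
      have := abs_le.mp (hC x (Ioo_subset_Icc_self hx))
      simp only [Pi.add_apply] at this
      rw [abs_le]
      constructor <;> linarith
    have h4 : |2 * (W x - U x) * (V x - Y x)| ≤ (W x - U x) ^ 2 + (V x - Y x) ^ 2 := by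
      rw [abs_le]
      constructor <;> nlinarith [sq_nonneg (W x - U x + (V x - Y x)),
        sq_nonneg (W x - U x - (V x - Y x))]
    rw [abs_mul, mul_comm]
    exact mul_le_mul h3 h4 (abs_nonneg _) (by positivity)

lemma SolvesOn.energy_eq {lam : ℝ} {W V : ℝ → ℝ} {a b : ℝ} (hW : SolvesOn lam W V a b) {x y : ℝ}
    (hx : x ∈ Icc a b) (hy : y ∈ Icc a b) :
    V x ^ 2 + 4 * W x ^ 3 - 2 * lam * W x = V y ^ 2 + 4 * W y ^ 3 - 2 * lam * W y := by
  have hd : ∀ x ∈ interior (Icc a b),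
      HasDerivAt (fun x => V x ^ 2 + 4 * W x ^ 3 - 2 * lam * W x) 0 x := fun x hx => by
    rw [interior_Icc] at hx
    refine hasDerivAt_of_eq ((((hW.hasDerivAt_deriv x hx).pow 2).add
      (((hW.hasDerivAt x hx).pow 3).const_mul 4)).sub ((hW.hasDerivAt x hx).const_mul (2 * lam)))
      (fun _ => rfl) ?_
    push_cast
    ring
  have hc : ContinuousOn (fun x => V x ^ 2 + 4 * W x ^ 3 - 2 * lam * W x) (Icc a b) :=
    ((hW.cont_deriv.pow 2).add (continuousOn_const.mul (hW.cont.pow 3))).sub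
      (continuousOn_const.mul hW.cont)
  have hmono := monotoneOn_of_deriv_nonneg (convex_Icc a b) hc
    (fun x hx => (hd x hx).differentiableAt.differentiableWithinAt) fun x hx => (hd x hx).deriv.ge
  have hanti := antitoneOn_of_deriv_nonpos (convex_Icc a b) hc
    (fun x hx => (hd x hx).differentiableAt.differentiableWithinAt) fun x hx => (hd x hx).deriv.le
  rcases le_total x y with h | h
  · exact le_antisymm (hmono hx hy h) (hanti hx hy h)
  · exact le_antisymm (hanti hy hx h) (hmono hy hx h)

/-- Two critical values determine the parameter. -/
lemma SolvesOn.param_eq {lam : ℝ} {W V : ℝ → ℝ} {a b x y : ℝ} (hW : SolvesOn lam W V a b)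
    (hx : x ∈ Icc a b) (hy : y ∈ Icc a b) (hVx : V x = 0) (hVy : V y = 0) (hne : W x ≠ W y) :
    lam = 2 * (W x ^ 2 + W x * W y + W y ^ 2) := by
  have h1 := hW.energy_eq hx hy
  rw [hVx, hVy] at h1
  apply mul_left_cancel₀ (sub_ne_zero.mpr hne)
  linear_combination -h1 / 2

/-! ### Classification of the Neumann solutions -/

lemma IsNeumannSolution.solvesOn {lam : ℝ} {W : ℝ → ℝ} (hW : IsNeumannSolution lam W) :
    SolvesOn lam W (derivWithin W (Icc 0 (1 / 2))) 0 (1 / 2) := by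
  have hmem : ∀ x ∈ Ioo (0 : ℝ) (1 / 2), Icc (0 : ℝ) (1 / 2) ∈ 𝓝 x := fun x hx =>
    Icc_mem_nhds hx.1 hx.2
  have heq : ∀ x ∈ Ioo (0 : ℝ) (1 / 2), derivWithin W (Icc 0 (1 / 2)) x = deriv W x :=
    fun x hx => derivWithin_of_mem_nhds (hmem x hx)
  refine ⟨hW.contDiffOn.continuousOn, hW.contDiffOn.continuousOn_derivWithin
    (uniqueDiffOn_Icc (by norm_num)) le_rfl, fun x hx => ?_, fun x hx => ?_⟩
  · rw [heq x hx]
    exact ((hW.contDiffOn.contDiffAt (hmem x hx)).differentiableAt one_ne_zero).hasDerivAt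
  · have h1 := (hW.differentiableAt x hx).hasDerivAt
    rw [show deriv (deriv W) x = lam - 6 * W x ^ 2 by linarith [hW.ode x hx]] at h1
    refine h1.congr_of_eventuallyEq ?_
    filter_upwards [Ioo_mem_nhds hx.1 hx.2] with y hy using heq y hy

lemma IsNeumannSolution.congr {lam : ℝ} {W U : ℝ → ℝ} (hU : IsNeumannSolution lam U)
    (h : EqOn W U (Icc 0 (1 / 2))) : IsNeumannSolution lam W := by
  have hev : ∀ x ∈ Ioo (0 : ℝ) (1 / 2), W =ᶠ[𝓝 x] U := fun x hx =>
    h.eventuallyEq_of_mem (Icc_mem_nhds hx.1 hx.2)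
  refine ⟨hU.contDiffOn.congr h, fun x hx => ?_, fun x hx => ?_, ?_, ?_⟩
  · exact (hev x hx).deriv.differentiableAt_iff.mpr (hU.differentiableAt x hx)
  · rw [(hev x hx).deriv.deriv_eq, h (Ioo_subset_Icc_self hx)]
    exact hU.ode x hx
  · rw [derivWithin_congr h (h (by norm_num))]
    exact hU.neumann_left
  · rw [derivWithin_congr h (h (by norm_num))]
    exact hU.neumann_right

lemma isNeumannSolution_waveFourier (n : ℕ) {h : ℝ} (hh : |h| < 1) :
    IsNeumannSolution (lambdaFourier n h) (waveFourier n h) := by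
  obtain ⟨p', hp, hp'⟩ := exists_wave_deriv n hh
  have hder : deriv (waveFourier n h) = p' := funext fun x => (hp x).deriv
  have hw : ∀ x ∈ Icc (0 : ℝ) (1 / 2), derivWithin (waveFourier n h) (Icc 0 (1 / 2)) x = p' x :=
    fun x hx => (hp x).hasDerivWithinAt.derivWithin (uniqueDiffOn_Icc (by norm_num) x hx)
  refine ⟨?_, fun x _ => ?_, fun x _ => ?_, ?_, ?_⟩
  · refine (contDiff_one_iff_deriv.mpr ⟨fun x => (hp x).differentiableAt, ?_⟩).contDiffOn
    rw [hder]
    exact continuous_iff_continuousAt.mpr fun x => (hp' x).continuousAt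
  · rw [hder]
    exact (hp' x).differentiableAt
  · rw [hder, (hp' x).deriv]
    ring
  · rw [hw 0 (by norm_num)]
    exact (hp 0).eq_zero_of_reflection (waveFourier_reflect_zero n h)
  · rw [hw (1 / 2) (by norm_num)]
    exact (hp (1 / 2)).eq_zero_of_reflection (waveFourier_reflect_half n h)

/-- By uniqueness for the ODE, a critical point y is a centre of reflection of the wave. Hence the
value at 2y equals the maximum at 0, which forces cos(4πy) = 1. -/
lemma two_mul_eq_int_of_deriv_eq_zero {h : ℝ} (h0 : 0 < h) (h1 : h < 1) {p' : ℝ → ℝ}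
    (hp : ∀ x, HasDerivAt (waveFourier 1 h) (p' x) x)
    (hp' : ∀ x, HasDerivAt p' (lambdaFourier 1 h - 6 * waveFourier 1 h x ^ 2) x)
    {y : ℝ} (hy : p' y = 0) : ∃ j : ℤ, 2 * y = j := by
  have hq := SolvesOn.of_hasDerivAt (lam := lambdaFourier 1 h)
    (W := fun x => waveFourier 1 h (2 * y - x)) (V := fun x => -p' (2 * y - x))
    (fun x => HasDerivAt.comp_const_sub (2 * y) x (hp _))
    (fun x => hasDerivAt_of_eq (HasDerivAt.comp_const_sub (2 * y) x (hp' _)).neg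
      (fun _ => rfl) (by ring)) (min y 0) (max y 0)
  have hyy : 2 * y - y = y := by ring
  have h2 := (hq.unique (SolvesOn.of_hasDerivAt hp hp' _ _) (t := y) (x := 0) (by simp)
    (by simp only [hyy]) (by simp only [hyy, hy, neg_zero]) (by simp)).1
  simp only [sub_zero] at h2
  have h3 := waveFourier_one_sub_ge h0.le h1 (2 * y)
  rw [h2, sub_self] at h3
  have h4 : 0 < 8 * Real.pi ^ 2 * h := by positivity
  have h5 : Real.cos (2 * Real.pi * (2 * y)) = 1 :=
    le_antisymm (Real.cos_le_one _) (by linarith [nonpos_of_mul_nonpos_right h3 h4])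
  obtain ⟨j, hj⟩ := (Real.cos_eq_one_iff _).mp h5
  refine ⟨j, ?_⟩
  have := Real.pi_pos
  apply mul_left_cancel₀ (show 2 * Real.pi ≠ 0 by positivity)
  linarith

lemma SolvesOn.exists_extremes {lam : ℝ} {W V : ℝ → ℝ} (hW : SolvesOn lam W V 0 (1 / 2))
    (hV0 : V 0 = 0) (hV1 : V (1 / 2) = 0)
    (hne : ∃ x ∈ Icc (0 : ℝ) (1 / 2), ∃ y ∈ Icc (0 : ℝ) (1 / 2), W x ≠ W y) :
    ∃ y ∈ Icc (0 : ℝ) (1 / 2), ∃ z ∈ Icc (0 : ℝ) (1 / 2), V y = 0 ∧ V z = 0 ∧ W y < W z ∧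
      0 < W z + 2 * W y := by
  have hnonempty : (Icc (0 : ℝ) (1 / 2)).Nonempty := ⟨0, by norm_num⟩
  obtain ⟨y, hy, hmin⟩ := isCompact_Icc.exists_isMinOn hnonempty hW.cont
  obtain ⟨z, hz, hmax⟩ := isCompact_Icc.exists_isMaxOn hnonempty hW.cont
  have hV : ∀ x ∈ Icc (0 : ℝ) (1 / 2), IsExtrOn W (Icc 0 (1 / 2)) x → V x = 0 := by
    intro x hx hext
    rcases eq_or_lt_of_le hx.1 with h0 | h0
    · rw [← h0, hV0]
    rcases eq_or_lt_of_le hx.2 with h1 | h1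
    · rw [h1, hV1]
    exact (hext.isLocalExtr (Icc_mem_nhds h0 h1)).hasDerivAt_eq_zero (hW.hasDerivAt x ⟨h0, h1⟩)
  have hVy := hV y hy (Or.inl hmin)
  have hVz := hV z hz (Or.inr hmax)
  have hlt : W y < W z := by
    refine lt_of_le_of_ne (hmin hz) fun heq => ?_
    obtain ⟨a, ha, b, hb, hab⟩ := hne
    have hconst : ∀ x ∈ Icc (0 : ℝ) (1 / 2), W x = W y := fun x hx =>
      le_antisymm ((hmax hx).trans heq.ge) (hmin hx)
    exact hab ((hconst a ha).trans (hconst b hb).symm)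
  refine ⟨y, hy, z, hz, hVy, hVz, hlt, ?_⟩
  have hlam := hW.param_eq hy hz hVy hVz hlt.ne
  -- All values between the extremes are attained, and there W'² = 4(M - W)(W - m)(W + M + m) makes
  -- the last factor nonnegative; letting W tend to m gives M + 2m ≥ 0.
  have hnonneg : ∀ w ∈ Ioo (W y) (W z), 0 ≤ w + W z + W y := by
    intro w hw
    obtain ⟨x, hx, rfl⟩ := isPreconnected_Icc.intermediate_value hy hz hW.cont
      (Ioo_subset_Icc_self hw)
    have hE := hW.energy_eq hx hy
    rw [hVy, hlam] at hE
    have h1 : V x ^ 2 = 4 * ((W z - W x) * (W x - W y)) * (W x + W z + W y) := by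
      linear_combination hE
    have h2 : 0 < 4 * ((W z - W x) * (W x - W y)) := by
      have := mul_pos (sub_pos.mpr hw.2) (sub_pos.mpr hw.1)
      linarith
    exact nonneg_of_mul_nonneg_right (h1 ▸ sq_nonneg (V x)) h2
  have hge : 0 ≤ W z + 2 * W y := by
    by_contra! hneg
    obtain ⟨w, hw1, hw2⟩ := exists_between (show W y < min (W z) (-W z - W y) from
      lt_min hlt (by linarith))
    have := hnonneg w ⟨hw1, hw2.trans_le (min_le_left _ _)⟩
    have := hw2.trans_le (min_le_right _ _)
    linarith
  -- The homoclinic case: M = -2m gives λ = 6m², so m is an equilibrium, and a solution touching it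
  -- with zero slope is constant.
  refine lt_of_le_of_ne hge fun h0 => ?_
  have hz' : W z = -2 * W y := by linarith
  rw [hz'] at hlam
  have hconst := SolvesOn.of_hasDerivAt (lam := lam) (W := fun _ => W y) (V := fun _ => 0)
    (fun x => hasDerivAt_const _ _)
    (fun x => hasDerivAt_of_eq (hasDerivAt_const x 0) (fun _ => rfl) (by rw [hlam]; ring))
    0 (1 / 2)
  exact hlt.ne' (hW.unique hconst hy rfl hVy hz).1

/-- Every non-constant Neumann solution lies on one of the Fourier branches. -/
lemma IsNeumannSolution.exists_eq_waveFourier {lam : ℝ} {W : ℝ → ℝ}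
    (hW : IsNeumannSolution lam W)
    (hne : ∃ x ∈ Icc (0 : ℝ) (1 / 2), ∃ y ∈ Icc (0 : ℝ) (1 / 2), W x ≠ W y) :
    ∃ n : ℕ, 1 ≤ n ∧ ∃ h ∈ Ioo (0 : ℝ) 1, lam = lambdaFourier n h ∧
      (EqOn W (waveFourier n h) (Icc 0 (1 / 2)) ∨ EqOn W (waveFourier n (-h)) (Icc 0 (1 / 2))) := by
  have hS := hW.solvesOn
  have hV0 := hW.neumann_left
  have hV1 := hW.neumann_right
  set V := derivWithin W (Icc 0 (1 / 2))
  obtain ⟨y, hy, z, hz, hVy, hVz, hlt, hpos⟩ := hS.exists_extremes hV0 hV1 hne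
  have hlam := hS.param_eq hz hy hVz hVy hlt.ne'
  obtain ⟨h, hh, c, hc, hM, hm⟩ := exists_wave_of_extremes hlt hpos
  have hh1 : |h| < 1 := abs_lt.mpr ⟨by linarith [hh.1], hh.2⟩
  obtain ⟨p', hp, hp'⟩ := exists_wave_deriv 1 hh1
  have hp0 : p' 0 = 0 := (hp 0).eq_zero_of_reflection (waveFourier_reflect_zero 1 h)
  have hp1 : p' (1 / 2) = 0 := (hp (1 / 2)).eq_zero_of_reflection (waveFourier_reflect_half 1 h)
  have hlam1 := (SolvesOn.of_hasDerivAt hp hp' 0 (1 / 2)).param_eq (x := 0) (y := 1 / 2)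
    (by norm_num) (by norm_num) hp0 hp1 (waveFourier_one_half_lt hh.1 hh.2).ne'
  have hlamc : lam = c ^ 4 * lambdaFourier 1 h := by
    rw [hlam, hlam1, hM, hm]; ring
  have hlin : ∀ x : ℝ, HasDerivAt (fun x : ℝ => c * (x - z)) c x := fun x => by
    simpa using ((hasDerivAt_id x).sub_const z).const_mul c
  -- The scaled wave is centred at the maximum point z of W, so both have the same value and zero
  -- slope there.
  have hU := SolvesOn.of_hasDerivAt (lam := lam) (W := fun x => c ^ 2 * waveFourier 1 h (c * (x - z)))
    (V := fun x => c ^ 3 * p' (c * (x - z)))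
    (fun x => hasDerivAt_of_eq (((hp _).comp x (hlin x)).const_mul (c ^ 2)) (fun _ => rfl)
      (by ring))
    (fun x => hasDerivAt_of_eq (((hp' _).comp x (hlin x)).const_mul (c ^ 3)) (fun _ => rfl)
      (by rw [hlamc]; ring)) 0 (1 / 2)
  have hEq : ∀ x ∈ Icc (0 : ℝ) (1 / 2), W x = c ^ 2 * waveFourier 1 h (c * (x - z)) ∧
      V x = c ^ 3 * p' (c * (x - z)) := fun x hx =>
    hS.unique hU hz (by simpa using hM) (by simp [hVz, hp0]) hx
  have hcrit : ∀ x ∈ Icc (0 : ℝ) (1 / 2), V x = 0 → ∃ j : ℤ, 2 * (c * (x - z)) = j :=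
    fun x hx hVx => two_mul_eq_int_of_deriv_eq_zero hh.1 hh.2 hp hp' (by
      have h2 := (hEq x hx).2
      rw [hVx] at h2
      exact (mul_eq_zero.mp h2.symm).resolve_left (by positivity))
  -- The endpoints give -2cz = i and c(1 - 2z) = j, whence c = j - i. The remaining phase is i/2:
  -- the parity of i selects h or -h.
  obtain ⟨i, hi⟩ := hcrit 0 (by norm_num) hV0
  obtain ⟨j, hj⟩ := hcrit (1 / 2) (by norm_num) hV1
  have hcij : c = ((j - i : ℤ) : ℝ) := by push_cast; linarith
  have hij : 0 < j - i := by
    have : (0 : ℝ) < ((j - i : ℤ) : ℝ) := hcij ▸ hc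
    exact_mod_cast this
  obtain ⟨n, hn⟩ := Int.eq_ofNat_of_zero_le hij.le
  have hcn : c = n := by rw [hcij, hn]; simp
  have harg : ∀ x, c * (x - z) = n * x + i / 2 := fun x => by rw [← hcn, ← hi]; ring
  refine ⟨n, by omega, h, hh, by rw [hlamc, lambdaFourier_scale n, hcn], ?_⟩
  rcases Int.even_or_odd' i with ⟨k, hk | hk⟩
  · left
    intro x hx
    rw [(hEq x hx).1, harg, hk, hcn, waveFourier_scale n]
    push_cast
    rw [show (2 * (k : ℝ)) / 2 = k by ring, waveFourier_one_add_int]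
  · right
    intro x hx
    rw [(hEq x hx).1, harg, hk, hcn, waveFourier_scale n, waveFourier_one_neg]
    push_cast
    rw [show n * x + (2 * (k : ℝ) + 1) / 2 = n * x + 1 / 2 + k by ring, waveFourier_one_add_int]

/-- The comparison point is half a period of the n-th wave; x = 1/2 would give no gap for even n.
The bound is linear in |h|, as transversality requires. -/
lemma waveFourier_gap {n : ℕ} (hn : 1 ≤ n) {h : ℝ} (hh : |h| < 1) :
    16 * (n * Real.pi) ^ 2 * |h| ≤ |waveFourier n h 0 - waveFourier n h (1 / (2 * n))| := by
  have hn0 : (n : ℝ) ≠ 0 := by positivity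
  have h1 : waveFourier n h 0 = n ^ 2 * waveFourier 1 h 0 := by rw [waveFourier_scale, mul_zero]
  have h2 : waveFourier n h (1 / (2 * n)) = n ^ 2 * waveFourier 1 h (1 / 2) := by
    rw [waveFourier_scale]; congr 2; field_simp
  have key : 16 * Real.pi ^ 2 * |h| ≤ |waveFourier 1 h 0 - waveFourier 1 h (1 / 2)| := by
    rcases le_total 0 h with h0 | h0
    · rw [abs_of_nonneg h0] at hh ⊢
      exact (waveFourier_one_half_gap h0 hh).trans (le_abs_self _)
    · rw [abs_of_nonpos h0] at hh ⊢
      have h3 := waveFourier_one_half_gap (neg_nonneg.mpr h0) hh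
      have h4 := waveFourier_one_add_int h 0 1
      rw [waveFourier_one_neg, waveFourier_one_neg, zero_add,
        show (1 / 2 + 1 / 2 : ℝ) = 0 + (1 : ℤ) by norm_num, h4] at h3
      rw [abs_sub_comm]
      exact h3.trans (le_abs_self _)
  rw [h1, h2, ← mul_sub, abs_mul, abs_of_nonneg (by positivity : (0 : ℝ) ≤ (n : ℝ) ^ 2)]
  calc _ = (n : ℝ) ^ 2 * (16 * Real.pi ^ 2 * |h|) := by ring
    _ ≤ _ := by gcongr

lemma one_div_two_mul_mem {n : ℕ} (hn : 1 ≤ n) : 1 / (2 * (n : ℝ)) ∈ Icc (0 : ℝ) (1 / 2) := by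
  have : (1 : ℝ) ≤ n := by exact_mod_cast hn
  exact ⟨by positivity, by gcongr; linarith⟩

lemma waveFourier_nonconstant {n : ℕ} (hn : 1 ≤ n) {h : ℝ} (h0 : h ≠ 0) (hh : |h| < 1) :
    waveFourier n h 0 ≠ waveFourier n h (1 / (2 * n)) := by
  intro heq
  have h1 := waveFourier_gap hn hh
  rw [heq, sub_self, abs_zero] at h1
  have : 0 < |h| := abs_pos.mpr h0
  have : 0 < 16 * (n * Real.pi) ^ 2 * |h| := by positivity
  linarith

lemma nonconstant_neumann_iff (lam : ℝ) (W : ℝ → ℝ) :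
    (IsNeumannSolution lam W ∧
        ∃ x ∈ Icc (0 : ℝ) (1 / 2), ∃ y ∈ Icc (0 : ℝ) (1 / 2), W x ≠ W y) ↔
      ∃ (n : ℕ) (τ : ℍ), 1 ≤ n ∧ τ.re = 0 ∧
        (lam : ℂ) = 1 / 2 * (n : ℂ) ^ 4 * gTwo τ ∧
        ((∀ x ∈ Icc (0 : ℝ) (1 / 2),
            (W x : ℂ) = -(n : ℂ) ^ 2 * wpFun τ ((τ : ℂ) / 2 + n * x)) ∨
          (∀ x ∈ Icc (0 : ℝ) (1 / 2),
            (W x : ℂ) = -(n : ℂ) ^ 2 * wpFun τ (1 / 2 + (τ : ℂ) / 2 + n * x))) := by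
  constructor
  · rintro ⟨hW, hne⟩
    obtain ⟨n, hn, h, hh, hlam, hEq⟩ := hW.exists_eq_waveFourier hne
    obtain ⟨τ, hτ, rfl⟩ := exists_upperHalfPlane hh.1 hh.2
    refine ⟨n, τ, hn, hτ, by rw [gTwo_eq hτ, hlam], hEq.imp (fun hE x hx => ?_) fun hE x hx => ?_⟩
    · rw [neg_wpFun_second hτ, hE hx]
    · rw [neg_wpFun_third hτ, hE hx]
  · rintro ⟨n, τ, hn, hτ, hlam, hEq⟩
    have hm := exp_neg_pi_mul_im_mem τ
    have hh1 : |Real.exp (-Real.pi * τ.im)| < 1 := abs_lt.mpr ⟨by linarith [hm.1], hm.2⟩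
    have key : ∃ h : ℝ, h ≠ 0 ∧ |h| < 1 ∧ lam = lambdaFourier n h ∧
        EqOn W (waveFourier n h) (Icc 0 (1 / 2)) := by
      rw [gTwo_eq hτ] at hlam
      have hlam' := Complex.ofReal_injective hlam
      rcases hEq with hE | hE
      · refine ⟨_, hm.1.ne', hh1, hlam', fun x hx => ?_⟩
        have := hE x hx
        rw [neg_wpFun_second hτ] at this
        exact Complex.ofReal_injective this
      · refine ⟨-_, neg_ne_zero.mpr hm.1.ne', by rwa [abs_neg], by rw [lambdaFourier_neg, hlam'],
          fun x hx => ?_⟩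
        have := hE x hx
        rw [neg_wpFun_third hτ] at this
        exact Complex.ofReal_injective this
    obtain ⟨h, h0, hh, rfl, hE⟩ := key
    refine ⟨(isNeumannSolution_waveFourier n hh).congr hE, 0, by norm_num, _,
      one_div_two_mul_mem hn, ?_⟩
    rw [hE (by norm_num), hE (one_div_two_mul_mem hn)]
    exact waveFourier_nonconstant hn h0 hh

/-! ### The pitchfork bifurcations -/

lemma isNeumannSolution_const {lam : ℝ} (h : 0 ≤ lam) :
    IsNeumannSolution lam fun _ => √(lam / 6) := by
  refine ⟨contDiffOn_const, fun x _ => by simp, fun x _ => ?_, by simp, by simp⟩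
  rw [Real.sq_sqrt (by positivity)]
  simp
  ring

lemma IsNeumannSolution.eq_of_const {lam a : ℝ} {W : ℝ → ℝ} (hW : IsNeumannSolution lam W)
    (hc : EqOn W (fun _ => a) (Icc 0 (1 / 2))) : 6 * a ^ 2 = lam := by
  have hx : (1 / 4 : ℝ) ∈ Ioo (0 : ℝ) (1 / 2) := by norm_num
  have hev : W =ᶠ[𝓝 (1 / 4)] fun _ => a := hc.eventuallyEq_of_mem (Icc_mem_nhds hx.1 hx.2)
  have h1 := hW.ode _ hx
  rw [hev.deriv.deriv_eq, hev.eq_of_nhds] at h1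
  simp at h1
  linarith

lemma deriv_lambdaFourier_zero (n : ℕ) : deriv (lambdaFourier n) 0 = 0 :=
  ((contDiffAt_lambdaFourier n (h := 0) (by simp) 1).differentiableAt
    one_ne_zero).hasDerivAt.eq_zero_of_reflection fun x => by
      rw [mul_zero, zero_sub, lambdaFourier_neg]

/-- If λ'' ≤ 0 at 0, then λ - Lh² has negative second derivative and so a local maximum at 0,
against the growth by at least 240Lh² of λ. -/
lemma deriv_deriv_lambdaFourier_pos {n : ℕ} (hn : 1 ≤ n) :
    0 < deriv (deriv (lambdaFourier n)) 0 := by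
  by_contra! hle
  set L := 2 / 3 * (n * Real.pi) ^ 4
  have hn0 : (0 : ℝ) < n := by exact_mod_cast hn
  have hL : 0 < L := by positivity
  have hdiff : ∀ h : ℝ, |h| < 1 → HasDerivAt (fun h => lambdaFourier n h - L * h ^ 2)
      (deriv (lambdaFourier n) h - L * (2 * h)) h := fun h hh => by
    refine hasDerivAt_of_eq (((contDiffAt_lambdaFourier n hh 1).differentiableAt
      one_ne_zero).hasDerivAt.sub ((hasDerivAt_pow 2 h).const_mul L)) (fun _ => rfl) ?_
    norm_num
  have hev : deriv (fun h => lambdaFourier n h - L * h ^ 2) =ᶠ[𝓝 0]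
      fun h => deriv (lambdaFourier n) h - L * (2 * h) := by
    filter_upwards [(isOpen_lt continuous_abs continuous_const).mem_nhds
      (show |(0 : ℝ)| < 1 by simp)] with h hh using (hdiff h hh).deriv
  have hd2 : DifferentiableAt ℝ (deriv (lambdaFourier n)) 0 := by
    have h2 : ContDiffAt ℝ (1 + 1) (lambdaFourier n) 0 := contDiffAt_lambdaFourier n (by simp) _
    exact (h2.derivWithin le_rfl).differentiableAt one_ne_zero
  have hsecond : deriv (deriv fun h => lambdaFourier n h - L * h ^ 2) 0 =
      deriv (deriv (lambdaFourier n)) 0 - L * 2 := by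
    rw [hev.deriv_eq]
    refine HasDerivAt.deriv (hasDerivAt_of_eq (hd2.hasDerivAt.sub
      (((hasDerivAt_id (0 : ℝ)).const_mul 2).const_mul L)) (fun _ => rfl) ?_)
    ring
  have hmax := isLocalMax_of_deriv_deriv_neg (f := fun h => lambdaFourier n h - L * h ^ 2)
    (x₀ := 0) (by rw [hsecond]; linarith)
    (by rw [(hdiff 0 (by simp)).deriv, deriv_lambdaFourier_zero]; simp)
    (hdiff 0 (by simp)).continuousAt
  obtain ⟨h, hle', hmem⟩ := ((hmax.filter_mono (nhdsWithin_le_nhds (s := Ioi 0))).and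
    (Ioo_mem_nhdsGT (one_pos (α := ℝ)))).exists
  have h1 := lambdaFourier_ge n (h := h) (abs_lt.mpr ⟨by linarith [hmem.1], hmem.2⟩)
  simp only [lambdaFourier_zero] at hle'
  change L * (1 + 240 * h ^ 2) ≤ _ at h1
  change _ ≤ L - _ at hle'
  have : 0 < L * h ^ 2 := mul_pos hL (pow_pos hmem.1 2)
  nlinarith

/-- A zero derivative would make the difference of the two point evaluations o(h), contradicting the
linear gap; the constant 8(nπ)² is half the slope of that gap. -/
lemma deriv_realBranch_ne_zero {n : ℕ} (hn : 1 ≤ n) : deriv (realBranch n) 0 ≠ 0 := by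
  intro h0
  have hd : HasDerivAt (realBranch n) 0 0 := h0 ▸
    ((contDiffAt_realBranch n (h := 0) (by simp) 1).differentiableAt one_ne_zero).hasDerivAt
  set x₀ : Icc (0 : ℝ) (1 / 2) := ⟨0, by norm_num⟩
  set x₁ : Icc (0 : ℝ) (1 / 2) := ⟨_, one_div_two_mul_mem hn⟩
  let ℓ : C(Icc (0 : ℝ) (1 / 2), ℝ) →L[ℝ] ℝ :=
    ContinuousMap.evalCLM (M := ℝ) ℝ x₀ - ContinuousMap.evalCLM (M := ℝ) ℝ x₁
  have hφ : HasDerivAt (fun h => ℓ (realBranch n h)) 0 0 := by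
    exact hasDerivAt_of_eq (ℓ.hasFDerivAt.comp_hasDerivAt (0 : ℝ) hd) (fun _ => rfl)
      (map_zero ℓ).symm
  have hℓ : ∀ h : ℝ, |h| < 1 →
      ℓ (realBranch n h) = waveFourier n h 0 - waveFourier n h (1 / (2 * n)) := fun h hh => by
    rw [← realBranch_apply n hh x₀, ← realBranch_apply n hh x₁]
    rfl
  have hn0 : (0 : ℝ) < n := by exact_mod_cast hn
  have hc : 0 < 8 * (n * Real.pi) ^ 2 := by positivity
  have h1 := (hasDerivAt_iff_isLittleO.mp hφ).def hc
  obtain ⟨h, hle, hmem⟩ := ((h1.filter_mono (nhdsWithin_le_nhds (s := Ioi 0))).and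
    (Ioo_mem_nhdsGT (one_pos (α := ℝ)))).exists
  have hh : |h| < 1 := abs_lt.mpr ⟨by linarith [hmem.1], hmem.2⟩
  rw [hℓ h hh, hℓ 0 (by simp), waveFourier_zero, waveFourier_zero] at hle
  simp only [sub_self, sub_zero, smul_zero, Real.norm_eq_abs] at hle
  have h2 := waveFourier_gap hn hh
  have : 0 < 8 * (n * Real.pi) ^ 2 * |h| := mul_pos hc (abs_pos.mpr hmem.1.ne')
  linarith

lemma lambdaFourier_nonneg (n : ℕ) {h : ℝ} (hh : |h| < 1) : 0 ≤ lambdaFourier n h :=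
  le_trans (by positivity) (lambdaFourier_ge n hh)

lemma sqrt_lambda_div_six (n : ℕ) :
    1 / 3 * (n * Real.pi) ^ 2 = √((2 / 3 * (n * Real.pi) ^ 4) / 6) := by
  rw [show (2 / 3 * (n * Real.pi) ^ 4) / 6 = (1 / 3 * (n * Real.pi) ^ 2) ^ 2 by ring,
    Real.sqrt_sq (by positivity)]

/-- The modes `N < n` are excluded near the bifurcation point of mode `n`. -/
lemma exists_lower_mode_bound {n : ℕ} (hn : 1 ≤ n) :
    ∃ μ < 2 / 3 * (n * Real.pi) ^ 4, ∃ δ > 0, ∀ N < n, ∀ h : ℝ, |h| < δ → |h| < 1 →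
      lambdaFourier N h < μ := by
  -- Scaling by N⁴ makes mode k = n - 1 the worst case, so one μ and one δ serve all lower modes.
  obtain ⟨k, rfl⟩ := Nat.exists_eq_add_of_le' hn
  have hlt : (k : ℝ) ^ 4 * lambdaFourier 1 0 < 2 / 3 * ((k + 1 : ℕ) * Real.pi) ^ 4 := by
    have h1 : (k : ℝ) ^ 4 < ((k + 1 : ℕ) : ℝ) ^ 4 := by
      apply pow_lt_pow_left₀ _ (by positivity) (by norm_num)
      push_cast; linarith
    have : 0 < Real.pi ^ 4 := by positivity
    rw [lambdaFourier_zero, mul_pow, mul_pow]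
    push_cast at h1 ⊢
    nlinarith
  obtain ⟨μ, hμ1, hμ2⟩ := exists_between hlt
  have hcont : ContinuousAt (fun h => (k : ℝ) ^ 4 * lambdaFourier 1 h) 0 :=
    continuousAt_const.mul (contDiffAt_lambdaFourier 1 (h := 0) (by simp) 0).continuousAt
  obtain ⟨δ, hδ, hball⟩ := Metric.eventually_nhds_iff.mp (hcont.eventually_lt_const hμ1)
  refine ⟨μ, hμ2, δ, hδ, fun N hN h hh hh1 => ?_⟩
  rw [lambdaFourier_scale N]
  have h1 : (N : ℝ) ^ 4 ≤ (k : ℝ) ^ 4 := by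
    have : (N : ℝ) ≤ k := by exact_mod_cast Nat.lt_succ_iff.mp hN
    gcongr
  exact (mul_le_mul_of_nonneg_right h1 (lambdaFourier_nonneg 1 hh1)).trans_lt
    (hball (by simpa using hh))

lemma eventually_mem_neumannSolutionSet_iff {n : ℕ} (hn : 1 ≤ n) {ε : ℝ} (hε : ε ∈ Ioo (0 : ℝ) 1) :
    ∀ᶠ p in 𝓝 (2 / 3 * (n * Real.pi) ^ 4,
        (ContinuousMap.const (Icc (0 : ℝ) (1 / 2)) √((2 / 3 * (n * Real.pi) ^ 4) / 6))),
      (p ∈ neumannSolutionSet ↔ (p.2 = ContinuousMap.const _ √(p.1 / 6) ∨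
        ∃ s : ℝ, |s| < ε ∧ p = (lambdaFourier n s, realBranch n s))) := by
  have hn0 : (0 : ℝ) < n := by exact_mod_cast hn
  have hpi := Real.pi_pos
  obtain ⟨μ, hμ, δ, hδ, hlow⟩ := exists_lower_mode_bound hn
  rw [← sqrt_lambda_div_six]
  set lam₀ := 2 / 3 * (n * Real.pi) ^ 4
  set a₀ := 1 / 3 * (n * Real.pi) ^ 2
  have ha₀ : 0 < a₀ := by positivity
  have hup : lam₀ < 2 / 3 * ((n + 1 : ℕ) * Real.pi) ^ 4 := by
    have : (n : ℝ) < (n + 1 : ℕ) := by push_cast; linarith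
    simp only [lam₀]
    gcongr
  -- Radius a₀ keeps constant solutions on the positive root. Radius 8π² min(ε, δ) limits the
  -- oscillation to less than 16π² min(ε, δ), so the gap bound gives |s| < min(ε, δ) for whatever
  -- mode N occurs.
  have hr : 0 < min a₀ (8 * Real.pi ^ 2 * min ε δ) :=
    lt_min ha₀ (mul_pos (by positivity) (lt_min hε.1 hδ))
  rw [nhds_prod_eq]
  filter_upwards [((lt_mem_nhds (show 0 < lam₀ by positivity)).and
    ((lt_mem_nhds hμ).and (gt_mem_nhds hup))).prod_mk (Metric.ball_mem_nhds
      (ContinuousMap.const (Icc (0 : ℝ) (1 / 2)) a₀) hr)] with p ⟨⟨hp0, hpμ, hpup⟩, hpball⟩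
  have hclose : ∀ x, |p.2 x - a₀| < min a₀ (8 * Real.pi ^ 2 * min ε δ) := fun x =>
    (ContinuousMap.dist_apply_le_dist (f := p.2) (g := ContinuousMap.const _ a₀) x).trans_lt hpball
  constructor
  · rintro ⟨W, hW, hpW⟩
    have hcl : ∀ x ∈ Icc (0 : ℝ) (1 / 2), |W x - a₀| < min a₀ (8 * Real.pi ^ 2 * min ε δ) :=
      fun x hx => by simpa only [hpW] using hclose ⟨x, hx⟩
    by_cases hne : ∃ x ∈ Icc (0 : ℝ) (1 / 2), ∃ y ∈ Icc (0 : ℝ) (1 / 2), W x ≠ W y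
    · right
      obtain ⟨N, s, hN, hs1, hlam, hE⟩ : ∃ (N : ℕ) (s : ℝ), 1 ≤ N ∧ |s| < 1 ∧
          p.1 = lambdaFourier N s ∧ EqOn W (waveFourier N s) (Icc 0 (1 / 2)) := by
        obtain ⟨N, hN, h, hh, hlam, hE⟩ := hW.exists_eq_waveFourier hne
        have hh1 : |h| < 1 := abs_lt.mpr ⟨by linarith [hh.1], hh.2⟩
        rcases hE with hE | hE
        · exact ⟨N, h, hN, hh1, hlam, hE⟩
        · exact ⟨N, -h, hN, by rwa [abs_neg], by rw [lambdaFourier_neg, hlam], hE⟩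
      have hN1 : (1 : ℝ) ≤ N := by exact_mod_cast hN
      have hs : |s| < min ε δ := by
        have h1 := waveFourier_gap hN hs1
        have hmem := one_div_two_mul_mem hN
        rw [← hE (by norm_num), ← hE hmem] at h1
        have h2 := (hcl 0 (by norm_num)).trans_le (min_le_right _ _)
        have h3 := (hcl _ hmem).trans_le (min_le_right _ _)
        have h4 : |W 0 - W (1 / (2 * N))| ≤ |W 0 - a₀| + |W (1 / (2 * N)) - a₀| := by
          rw [abs_sub_comm (W (1 / (2 * N))) a₀]
          exact abs_sub_le _ _ _
        have h5 : 16 * Real.pi ^ 2 * |s| ≤ 16 * (N * Real.pi) ^ 2 * |s| := by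
          gcongr
          exact le_mul_of_one_le_left hpi.le hN1
        have h6 : 0 < 16 * Real.pi ^ 2 := by positivity
        nlinarith
      -- Higher modes have λ at least its value at their own bifurcation point, above the window;
      -- lower modes with |s| < δ stay below μ.
      have hNn : N = n := by
        refine le_antisymm ?_ ?_
        · by_contra! hlt
          have h1 := lambdaFourier_ge N hs1
          have h2 : ((n + 1 : ℕ) : ℝ) ≤ N := by exact_mod_cast hlt
          have h3 : 2 / 3 * ((n + 1 : ℕ) * Real.pi) ^ 4 ≤
              2 / 3 * (N * Real.pi) ^ 4 * (1 + 240 * s ^ 2) :=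
            (show _ ≤ 2 / 3 * (N * Real.pi) ^ 4 by gcongr).trans
              (le_mul_of_one_le_right (by positivity) (by nlinarith [sq_nonneg s]))
          linarith
        · by_contra! hlt
          have := hlow N hlt s (hs.trans_le (min_le_right _ _)) hs1
          linarith
      subst hNn
      refine ⟨s, hs.trans_le (min_le_left _ _), Prod.ext hlam (ContinuousMap.ext fun x => ?_)⟩
      rw [hpW, hE x.2, ← realBranch_apply N hs1 x]
    · left
      push Not at hne
      have hconst : EqOn W (fun _ => W 0) (Icc 0 (1 / 2)) :=
        fun x hx => hne x hx 0 (by norm_num)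
      have h1 := hW.eq_of_const hconst
      have h2 := (abs_lt.mp ((hcl 0 (by norm_num)).trans_le (min_le_left _ _))).1
      have h3 : W 0 = √(p.1 / 6) := by
        rw [← h1, show 6 * W 0 ^ 2 / 6 = W 0 ^ 2 by ring, Real.sqrt_sq (by linarith)]
      refine ContinuousMap.ext fun x => ?_
      rw [hpW, hconst x.2, ContinuousMap.const_apply, ← h3]
  · rintro (h | ⟨s, hs, h⟩)
    · exact ⟨_, isNeumannSolution_const hp0.le, fun x => by rw [h, ContinuousMap.const_apply]⟩
    · have hs1 := hs.trans hε.2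
      rw [h]
      exact ⟨_, isNeumannSolution_waveFourier n hs1, realBranch_apply n hs1⟩

lemma isSupercriticalPitchfork_realBranch {n : ℕ} (hn : 1 ≤ n) :
    IsSupercriticalPitchfork neumannSolutionSet
      (fun lam => ContinuousMap.const (Icc (0 : ℝ) (1 / 2)) √(lam / 6))
      (2 / 3 * (n * Real.pi) ^ 4) (lambdaFourier n) (realBranch n) where
  smooth_trivial := by
    have hn0 : (0 : ℝ) < n := by exact_mod_cast hn
    have h1 : ContDiffAt ℝ ∞ (fun lam : ℝ => √(lam / 6)) (2 / 3 * (n * Real.pi) ^ 4) :=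
      (contDiffAt_id.div_const 6).sqrt (by simp only [id]; positivity)
    exact (ContinuousLinearMap.const ℝ (Icc (0 : ℝ) (1 / 2)) (M := ℝ)).contDiff.contDiffAt.comp _ h1
  smooth_param := contDiffAt_lambdaFourier n (by simp) _
  smooth_branch := contDiffAt_realBranch n (by simp) _
  param_zero := lambdaFourier_zero n
  branch_zero := ContinuousMap.ext fun x => by
    rw [realBranch_apply n (by simp), waveFourier_zero, sqrt_lambda_div_six,
      ContinuousMap.const_apply]
  deriv_param := deriv_lambdaFourier_zero n
  supercritical := deriv_deriv_lambdaFourier_pos hn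
  transverse := deriv_realBranch_ne_zero hn
  local_solutions := by
    filter_upwards [Ioo_mem_nhdsGT (one_pos (α := ℝ))] with ε hε
    exact eventually_mem_neumannSolutionSet_iff hn hε

theorem lemma3p1 :
    -- the non-constant real Neumann solutions
    (∀ (lam : ℝ) (W : ℝ → ℝ),
      (IsNeumannSolution lam W ∧
          ∃ x ∈ Icc (0 : ℝ) (1 / 2), ∃ y ∈ Icc (0 : ℝ) (1 / 2), W x ≠ W y) ↔
        ∃ (n : ℕ) (τ : ℍ), 1 ≤ n ∧ τ.re = 0 ∧
          (lam : ℂ) = 1 / 2 * (n : ℂ) ^ 4 * gTwo τ ∧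
          ((∀ x ∈ Icc (0 : ℝ) (1 / 2),
              (W x : ℂ) = -(n : ℂ) ^ 2 * wpFun τ ((τ : ℂ) / 2 + n * x)) ∨
            (∀ x ∈ Icc (0 : ℝ) (1 / 2),
              (W x : ℂ) = -(n : ℂ) ^ 2 * wpFun τ (1 / 2 + (τ : ℂ) / 2 + n * x)))) ∧
    -- absolute convergence of the Fourier series
    (∀ h : ℝ, |h| < 1 →
      Summable (fun k : ℕ+ => (ArithmeticFunction.sigma 3 (k : ℕ) : ℝ) * h ^ (2 * (k : ℕ))) ∧
      Summable (fun k : ℕ+ => (k : ℝ) * (h ^ (2 * (k : ℕ)) / (1 - h ^ (2 * (k : ℕ))))) ∧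
      ∀ (n : ℕ) (x : ℝ), Summable (fun k : ℕ+ =>
        (k : ℝ) * (h ^ (k : ℕ) / (1 - h ^ (2 * (k : ℕ)))) *
          Real.cos (2 * Real.pi * n * k * x))) ∧
    -- Fourier expansions, with `h = exp (-π θ)` or `h = -exp (-π θ)`, for `τ = i θ`
    (∀ (n : ℕ) (τ : ℍ), 1 ≤ n → τ.re = 0 →
      1 / 2 * (n : ℂ) ^ 4 * gTwo τ = lambdaFourier n (Real.exp (-Real.pi * τ.im)) ∧
      1 / 2 * (n : ℂ) ^ 4 * gTwo τ = lambdaFourier n (-Real.exp (-Real.pi * τ.im)) ∧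
      (∀ x : ℝ, -(n : ℂ) ^ 2 * wpFun τ ((τ : ℂ) / 2 + n * x) =
        waveFourier n (Real.exp (-Real.pi * τ.im)) x) ∧
      (∀ x : ℝ, -(n : ℂ) ^ 2 * wpFun τ (1 / 2 + (τ : ℂ) / 2 + n * x) =
        waveFourier n (-Real.exp (-Real.pi * τ.im)) x)) ∧
    -- supercritical pitchfork bifurcations at `h = 0`
    (∀ n : ℕ, 1 ≤ n →
      lambdaFourier n 0 = 2 / 3 * (n * Real.pi) ^ 4 ∧
      (∀ x : ℝ, waveFourier n 0 x = 1 / 3 * (n * Real.pi) ^ 2) ∧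
      1 / 3 * (n * Real.pi) ^ 2 = √((2 / 3 * (n * Real.pi) ^ 4) / 6) ∧
      ∃ w : ℝ → C(Icc (0 : ℝ) (1 / 2), ℝ),
        (∀ h : ℝ, |h| < 1 → ∀ x : Icc (0 : ℝ) (1 / 2), w h x = waveFourier n h x) ∧
        IsSupercriticalPitchfork neumannSolutionSet
          (fun lam => ContinuousMap.const _ √(lam / 6))
          (2 / 3 * (n * Real.pi) ^ 4) (lambdaFourier n) w) := by
  refine ⟨nonconstant_neumann_iff, fun h hh => ⟨summable_sigma_mul_pow (𝕜 := ℝ) (z := h) hh,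
    summable_lambert_even hh, summable_lambert_mul_cos hh⟩, fun n τ _ hτ => ⟨gTwo_eq hτ n, ?_,
    neg_wpFun_second hτ n, neg_wpFun_third hτ n⟩, fun n hn => ⟨lambdaFourier_zero n,
    waveFourier_zero n, sqrt_lambda_div_six n, realBranch n, fun h hh => realBranch_apply n hh,
    isSupercriticalPitchfork_realBranch hn⟩⟩
  rw [lambdaFourier_neg, gTwo_eq hτ]
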